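/- Call $w:\mathbb R\to\mathbb R$ a weight if it is locally integrable and positive almost everywhere. Let $1<p<\infty$, $p'=p/(p-1)$, $\|f\|_{L^p_w}=\left(\int_{\mathbb R}|f(x)|^pw(x)\,dx\right)^{1/p}$, and, for an operator $T$, put $\|T\|_{L^p_w}=\sup\{\|Tf\|_{L^p_w}:\ f \text{ measurable},\ \|f\|_{L^p_w}\le1\}$. Put $$M^+f(x)=\sup_{h>0}\frac1h\int_x^{x+h}|f(t)|\,dt,\qquad M^-f(x)=\sup_{h>0}\frac1h\int_{x-h}^{x}|f(t)|\,dt,$$ $$\|w\|_{A_p^+}=\sup_{x\in\mathbb R,\,h>0}\left(\frac1h\int_{x-h}^{x}w(t)\,dt\right)\left(\frac1h\int_x^{x+h}w(t)^{1-p'}\,dt\right)^{p-1},$$ $$\|w\|_{A_p^-}=\sup_{x\in\mathbb R,\,h>0}\left(\frac1h\int_{x}^{x+h}w(t)\,dt\right)\left(\frac1h\int_{x-h}^{x}w(t)^{1-p'}\,dt\right)^{p-1},$$ and let $A_p^\pm$ be the class of weights $w$ with $\|w\|_{A_p^\pm}<\infty$. **Theorem.** Let $1<p<\infty$. (i) There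 is a constant $c$ depending only on $p$ such that for every $w\in A_p^+$ $$\|M^+\|_{L^p_w}\le c\,\|w\|_{A_p^+}^{1/(p-1)},$$ and the exponent $1/(p-1)$ is best possible, in the following sense. If $\psi:(0,\infty)\to(0,\infty)$ is non-decreasing and $\psi(t)=o\left(t^{1/(p-1)}\right)$ as $t\to\infty$, then there is no constant $c$ such that $\|M^+\|_{L^p_w}\le c\,\psi\left(\|w\|_{A_p^+}\right)$ for all $w\in A_p^+$; and for every $\lambda>0$ $$\sup_{w\in A_p^+}\frac{\|M^+\|_{L^p_w}}{\|w\|_{A_p^+}^{\frac1{p-1}-\lambda}}=\infty.$$ (ii) The same holds with $M^+$, $A_p^+$ replaced throughout by $M^-$, $A_p^-$. -/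

import Mathlib

open MeasureTheory Set
open scoped ENNReal NNReal

noncomputable section

namespace OneSided

/-- A weight on the line: an almost everywhere positive, locally integrable function. -/
structure IsWeight (w : ℝ → ℝ) : Prop where
  locallyIntegrable : LocallyIntegrable w volume
  ae_pos : ∀ᵐ x ∂(volume : Measure ℝ), 0 < w x

/-- The measure `w(x) dx`. -/
def weightMeasure (w : ℝ → ℝ) : Measure ℝ :=
  volume.withDensity fun x => ENNReal.ofReal (w x)

/-- The right maximal function `M⁺ f (x) = sup_{h > 0} (1/h) ∫_x^{x+h} |f|`, with values in
`[0, ∞]`. -/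
def maximalRight (f : ℝ → ℝ) (x : ℝ) : ℝ≥0∞ :=
  ⨆ (h : ℝ) (_ : 0 < h), (∫⁻ t in Ioc x (x + h), ‖f t‖ₑ) / ENNReal.ofReal h

/-- The left maximal function `M⁻ f (x) = sup_{h > 0} (1/h) ∫_{x-h}^x |f|`, with values in
`[0, ∞]`. -/
def maximalLeft (f : ℝ → ℝ) (x : ℝ) : ℝ≥0∞ :=
  ⨆ (h : ℝ) (_ : 0 < h), (∫⁻ t in Ioc (x - h) x, ‖f t‖ₑ) / ENNReal.ofReal h

/-- The norm of an operator `T` on `L^p_w`, i.e. the supremum of `‖T f‖_{L^p_w}` over all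
`f ∈ L^p_w` with `‖f‖_{L^p_w} ≤ 1`. -/
def opNorm (p : ℝ) (w : ℝ → ℝ) (T : (ℝ → ℝ) → ℝ → ℝ≥0∞) : ℝ≥0∞ :=
  ⨆ (f : ℝ → ℝ) (_ : MemLp f (ENNReal.ofReal p) (weightMeasure w))
    (_ : eLpNorm f (ENNReal.ofReal p) (weightMeasure w) ≤ 1),
    eLpNorm (T f) (ENNReal.ofReal p) (weightMeasure w)

/-- The mean value over `(a, a + h]` of a function, taken with values in `[0, ∞]`
(used for almost everywhere nonnegative functions and `h > 0`). -/
def mean (g : ℝ → ℝ) (a h : ℝ) : ℝ≥0∞ :=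
  (∫⁻ t in Ioc a (a + h), ENNReal.ofReal (g t)) / ENNReal.ofReal h

/-- The right characteristic `‖w‖_{A_p^+}`; here `p / (p - 1) = p'`. -/
def charRight (p : ℝ) (w : ℝ → ℝ) : ℝ≥0∞ :=
  ⨆ (x : ℝ) (h : ℝ) (_ : 0 < h),
    mean w (x - h) h * (mean (fun t => w t ^ (1 - p / (p - 1))) x h) ^ (p - 1)

/-- The left characteristic `‖w‖_{A_p^-}`; here `p / (p - 1) = p'`. -/
def charLeft (p : ℝ) (w : ℝ → ℝ) : ℝ≥0∞ :=
  ⨆ (x : ℝ) (h : ℝ) (_ : 0 < h),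
    mean w x h * (mean (fun t => w t ^ (1 - p / (p - 1))) (x - h) h) ^ (p - 1)

/-- The class `A_p^+` of weights. -/
def ARight (p : ℝ) (w : ℝ → ℝ) : Prop := IsWeight w ∧ charRight p w < ∞

/-- The class `A_p^-` of weights. -/
def ALeft (p : ℝ) (w : ℝ → ℝ) : Prop := IsWeight w ∧ charLeft p w < ∞

/-- `ψ` is positive and non-decreasing on `(0, ∞)` and grows more slowly than `t ^ β`, that is,
`ψ t = o(t ^ β)` as `t → ∞`. -/
def GrowsSlower (ψ : ℝ → ℝ) (β : ℝ) : Prop :=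
  (∀ t, 0 < t → 0 < ψ t) ∧ MonotoneOn ψ (Ioi 0) ∧
    Asymptotics.IsLittleO Filter.atTop ψ (fun t => t ^ β)

/-- The exponent `β` is best possible in the bound of `N w` by a constant times `K w ^ β`, over
the weights `w` of the class `A`: the power cannot be replaced by `ψ (K w)` for any positive
non-decreasing function `ψ` growing more slowly than it and, in particular,
`sup_w N w / K w ^ (β - ε) = ∞` for every `ε > 0`. -/
def BestPossible (A : (ℝ → ℝ) → Prop) (N K : (ℝ → ℝ) → ℝ≥0∞) (β : ℝ) : Prop :=
  (∀ ψ : ℝ → ℝ, GrowsSlower ψ β →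
    ¬ ∃ c : ℝ≥0, ∀ w : ℝ → ℝ, A w → N w ≤ c * ENNReal.ofReal (ψ (K w).toReal)) ∧
  ∀ ε : ℝ, 0 < ε → ⨆ (w : ℝ → ℝ) (_ : A w), N w / K w ^ (β - ε) = ∞

end OneSided

end

/-!
# Sharp weighted bounds for the one-sided maximal functions

Write `w = σ ^ (1 - p)`, so that `σ` is the dual weight, and let `K` be the `A_p^+` characteristic
of `w`. The upper bound follows Buckley's scheme: an `A_p^+` weight satisfies a one-sided `A_s^+`
condition with `p - s` of the order of `K ^ (-1 / (p - 1))` and a constant comparable to `K`, which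
gives a weak type `(s, s)` inequality, and interpolation with `L^∞` costs a factor `1 / (p - s)`.
Thus `‖M⁺‖ ^ p` is at most a multiple of `K / (p - s)`, that is, of `K ^ (p / (p - 1))`.

The gain of integrability comes from a reverse Hölder inequality
(`IsDualWeight.reverse_holder`). If `(α, β)` is a component of the shadow in the rising sun lemma
for the primitive of `σ - λ`, then `σ` has average `λ` on `(α, β)` and average at least `λ` on its
right half, so `A_p^+` makes `w` small, and `σ` larger than a multiple of `λ K ^ (-1 / (p - 1))`, on
a fixed proportion of the left half (`IsDualWeight.measure_level_le`); integration over the levels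
`λ` gives the inequality. It is one-sided, since only levels above the averages of `σ` over
intervals starting at the left end point are admissible. Therefore the `A_s^+` condition is obtained
for intervals separated by a gap of comparable length (`IsDualWeight.gap_bound`). This is enough for
the weak type inequality: on a component `(α, β)` of `{M⁺ f > λ}` the Whitney pieces towards `β` are
compared with intervals that carry half of the mass of `f` further to the right, and the resulting
coefficients decay geometrically (`measure_Ioo_le_of_gap`).

The exponent is attained by the weights `|x| ^ ((p - 1) (1 - δ))` with `δ → 0`: the characteristic
is at most `(6 / δ) ^ (p - 1)`, while `M⁺ f = f / δ` on `(-1, 0)` for `f = |x| ^ (δ - 1)` there.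
By the upper bound, large norms force large characteristics, and both forms of optimality follow
(`bestPossible_of_attained`). The left-hand case is the image of the right-hand case under the
reflection `x ↦ -x`.
-/

namespace OneSided

variable {p K : ℝ} {σ w f : ℝ → ℝ}

/-! ### The rising sun lemma -/

/-- The points of `(a, b)` in the shadow of the graph of `G`, for light coming from the right. -/
def shadow (G : ℝ → ℝ) (a b : ℝ) : Set ℝ :=
  {x | x ∈ Ioo a b ∧ ∃ y ∈ Ioc x b, G x < G y}

theorem shadow_subset_Ioo (G : ℝ → ℝ) (a b : ℝ) : shadow G a b ⊆ Ioo a b := fun _ hx => hx.1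

theorem isOpen_shadow {G : ℝ → ℝ} (hG : Continuous G) (a b : ℝ) : IsOpen (shadow G a b) := by
  have : shadow G a b = Ioo a b ∩ ⋃ y ∈ Iic b, (Iio y ∩ {x | G x < G y}) := by
    ext x
    simp only [shadow, mem_ofPred_eq, mem_inter_iff, mem_iUnion, mem_Iic, mem_Iio, mem_Ioc,
      exists_prop]
    exact and_congr_right fun _ => exists_congr fun y => by tauto
  rw [this]
  exact isOpen_Ioo.inter (isOpen_biUnion fun y _ =>
    isOpen_Iio.inter (isOpen_lt hG continuous_const))

/-- On a component `(α, β)` of the shadow `G` stays below `G β`, and `G α = G β` unless `α` is the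
left end of the whole interval. -/
theorem component_shadow {G : ℝ → ℝ} (hG : Continuous G) {a b x : ℝ} (hx : x ∈ shadow G a b) :
    ∃ α β, a ≤ α ∧ α < β ∧ β ≤ b ∧ connectedComponentIn (shadow G a b) x = Ioo α β ∧
      (∀ z ∈ Icc α β, G z ≤ G β) ∧ (α = a ∨ G β ≤ G α) := by
  set U := shadow G a b with hU
  set I := connectedComponentIn U x with hI
  have hUo : IsOpen U := isOpen_shadow hG a b
  have hIo : IsOpen I := hUo.connectedComponentIn
  have hxI : x ∈ I := mem_connectedComponentIn hx
  have hIU : I ⊆ U := connectedComponentIn_subset U x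
  have hpre : IsPreconnected I := isPreconnected_connectedComponentIn
  have hIab : I ⊆ Ioo a b := hIU.trans (shadow_subset_Ioo G a b)
  have hbb : BddBelow I := ⟨a, fun z hz => (hIab hz).1.le⟩
  have hba : BddAbove I := ⟨b, fun z hz => (hIab hz).2.le⟩
  have hsub : Ioo (sInf I) (sSup I) ⊆ I :=
    IsConnected.Ioo_csInf_csSup_subset ⟨⟨x, hxI⟩, hpre⟩ hbb hba
  have hlo : ∀ z ∈ I, sInf I < z := by
    intro z hz
    obtain ⟨ε, hε, hb⟩ := Metric.isOpen_iff.1 hIo z hz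
    have : z - ε / 2 ∈ I := hb (by simp [abs_of_pos hε]; linarith)
    linarith [csInf_le hbb this]
  have hhi : ∀ z ∈ I, z < sSup I := by
    intro z hz
    obtain ⟨ε, hε, hb⟩ := Metric.isOpen_iff.1 hIo z hz
    have : z + ε / 2 ∈ I := hb (by simp [abs_of_pos hε]; linarith)
    linarith [le_csSup hba this]
  have hIeq : I = Ioo (sInf I) (sSup I) :=
    Subset.antisymm (fun z hz => ⟨hlo z hz, hhi z hz⟩) hsub
  set α := sInf I
  set β := sSup I
  have hαβ : α < β := (hlo x hxI).trans (hhi x hxI)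
  have haα : a ≤ α := le_csInf ⟨x, hxI⟩ fun z hz => (hIab hz).1.le
  have hβb : β ≤ b := csSup_le ⟨x, hxI⟩ fun z hz => (hIab hz).2.le
  have hαU : α ∉ U := by
    intro h
    have : Ico α β ⊆ I := by
      refine isPreconnected_Ico.subset_connectedComponentIn (x := x)
        ⟨(hlo x hxI).le, hhi x hxI⟩ fun z hz => ?_
      rcases hz.1.eq_or_lt with rfl | h'
      · exact h
      · exact hIU (hsub ⟨h', hz.2⟩)
    exact lt_irrefl _ (hlo α (this ⟨le_rfl, hαβ⟩))
  have hβU : β ∉ U := by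
    intro h
    have : Ioc α β ⊆ I := by
      refine isPreconnected_Ioc.subset_connectedComponentIn (x := x)
        ⟨hlo x hxI, (hhi x hxI).le⟩ fun z hz => ?_
      rcases hz.2.eq_or_lt with h' | h'
      · exact h' ▸ h
      · exact hIU (hsub ⟨hz.1, h'⟩)
    exact lt_irrefl _ (hhi β (this ⟨hαβ, le_rfl⟩))
  have haβ : a < β := haα.trans_lt hαβ
  have hin : ∀ z ∈ Ioo α β, G z ≤ G β := by
    intro z hz
    -- a maximum point `y` of `G` on `[z, b]` is not in the shadow, so it lies beyond `β`
    obtain ⟨y, hy, hmax⟩ := (isCompact_Icc (a := z) (b := b)).exists_isMaxOn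
      ⟨z, le_rfl, hz.2.le.trans hβb⟩ hG.continuousOn
    have hβy : β ≤ y := by
      by_contra! hlt
      have hyI : y ∈ I := hsub ⟨hz.1.trans_le hy.1, hlt⟩
      obtain ⟨_, v, hv, hlt'⟩ := hIU hyI
      exact absurd (hmax ⟨hy.1.trans hv.1.le, hv.2⟩) (not_le.2 hlt')
    have h1 : G z ≤ G y := hmax ⟨le_rfl, hz.2.le.trans hβb⟩
    rcases hβy.eq_or_lt with rfl | hlt
    · exact h1
    · refine h1.trans (not_lt.1 fun h2 => hβU ⟨⟨haβ, hlt.trans_le hy.2⟩, y, ⟨hlt, hy.2⟩, h2⟩)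
  refine ⟨α, β, haα, hαβ, hβb, hIeq, ?_, ?_⟩
  · intro z hz
    have : closure (Ioo α β) ⊆ {z | G z ≤ G β} :=
      closure_minimal hin (isClosed_le hG continuous_const)
    rw [closure_Ioo hαβ.ne] at this
    exact this hz
  · rcases haα.eq_or_lt with h | h
    · exact Or.inl h.symm
    · right
      by_contra! h2
      exact hαU ⟨⟨h, hαβ.trans_le hβb⟩, β, ⟨hαβ, hβb⟩, h2⟩

/-- The rising sun lemma in the form of a comparison principle: an inequality between two measures
that holds on all possible components of the shadow holds on the shadow. -/
theorem measure_shadow_le {G : ℝ → ℝ} (hG : Continuous G) {a b : ℝ} {μ ν : Measure ℝ}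
    (h : ∀ α β, a ≤ α → α < β → β ≤ b → (∀ z ∈ Icc α β, G z ≤ G β) → (α = a ∨ G β ≤ G α) →
      μ (Ioo α β) ≤ ν (Ioo α β)) :
    μ (shadow G a b) ≤ ν (shadow G a b) := by
  set U := shadow G a b
  have hUo : IsOpen U := isOpen_shadow hG a b
  set 𝒞 : Set (Set ℝ) := (fun x => connectedComponentIn U x) '' U
  have hopen : ∀ I ∈ 𝒞, IsOpen I := by
    rintro _ ⟨x, _, rfl⟩; exact hUo.connectedComponentIn
  have hdisj : 𝒞.PairwiseDisjoint id := by
    rintro _ ⟨x, hx, rfl⟩ _ ⟨y, hy, rfl⟩ hne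
    rw [Function.onFun, disjoint_left]
    intro z hz1 hz2
    exact hne (show connectedComponentIn U x = connectedComponentIn U y by
      rw [connectedComponentIn_eq hz1, connectedComponentIn_eq hz2])
  have hcount : 𝒞.Countable := by
    refine hdisj.countable_of_isOpen hopen ?_
    rintro _ ⟨x, hx, rfl⟩
    exact ⟨x, mem_connectedComponentIn hx⟩
  have hUn : U = ⋃₀ 𝒞 := by
    ext z
    constructor
    · exact fun hz => ⟨_, ⟨z, hz, rfl⟩, mem_connectedComponentIn hz⟩
    · rintro ⟨_, ⟨x, _, rfl⟩, hz⟩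
      exact connectedComponentIn_subset U x hz
  rw [hUn, measure_sUnion hcount hdisj fun I hI => (hopen I hI).measurableSet,
    measure_sUnion hcount hdisj fun I hI => (hopen I hI).measurableSet]
  refine ENNReal.tsum_le_tsum ?_
  rintro ⟨_, x, hx, rfl⟩
  obtain ⟨α, β, h1, h2, h3, h4, h5, h6⟩ := component_shadow hG hx
  simp only
  rw [h4]
  exact h α β h1 h2 h3 h5 h6

/-! ### Level sets and a reverse Hölder inequality -/

/-- The dual weight `σ` of an `A_p^+` weight `w = σ ^ (1 - p)`, in a normalized form: `σ` is
measurable and positive everywhere. The constant `K` bounds the characteristic of `w`. -/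
structure IsDualWeight (p K : ℝ) (σ : ℝ → ℝ) : Prop where
  measurable : Measurable σ
  pos : ∀ x, 0 < σ x
  locallyIntegrable : LocallyIntegrable σ volume
  bound : ∀ x h : ℝ, 0 < h →
    (∫⁻ t in Ioc (x - h) x, ENNReal.ofReal (σ t ^ (1 - p))) *
      (∫⁻ t in Ioc x (x + h), ENNReal.ofReal (σ t)) ^ (p - 1) ≤ ENNReal.ofReal (K * h ^ p)

theorem intervalIntegrable_of_locallyIntegrable {f : ℝ → ℝ} (hf : LocallyIntegrable f volume)
    (a b : ℝ) : IntervalIntegrable f volume a b :=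
  intervalIntegrable_iff.mpr <|
    (hf.integrableOn_isCompact isCompact_uIcc).mono_set uIoc_subset_uIcc

theorem setLIntegral_Ioc_eq_ofReal {f : ℝ → ℝ} (hf : LocallyIntegrable f volume)
    (h0 : ∀ x, 0 ≤ f x) {a b : ℝ} (hab : a ≤ b) :
    ∫⁻ t in Ioc a b, ENNReal.ofReal (f t) = ENNReal.ofReal (∫ t in a..b, f t) := by
  rw [intervalIntegral.integral_of_le hab, ofReal_integral_eq_lintegral_ofReal
    ((intervalIntegrable_iff_integrableOn_Ioc_of_le hab).1
      (intervalIntegrable_of_locallyIntegrable hf a b)) (ae_of_all _ h0)]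

theorem continuous_integral_sub_mul {f : ℝ → ℝ} (hf : LocallyIntegrable f volume) (a c : ℝ) :
    Continuous fun x => (∫ t in a..x, f t) - c * x :=
  (intervalIntegral.continuous_primitive
    (fun u v => intervalIntegrable_of_locallyIntegrable hf u v) a).sub
      (continuous_const.mul continuous_id)

/-- Tonelli's theorem for the sections of a measurable set. -/
theorem lintegral_mul_measure_section {m : Measure ℝ} [SFinite m] {E : Set (ℝ × ℝ)}
    (hE : MeasurableSet E) (S : Set ℝ) {φ : ℝ → ℝ≥0∞} (hφ : Measurable φ) :
    ∫⁻ l in S, φ l * m {x | (l, x) ∈ E} =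
      ∫⁻ x, (∫⁻ l in S, E.indicator (fun q => φ q.1) (l, x)) ∂m := by
  rw [lintegral_lintegral_swap]
  · refine lintegral_congr fun l => ?_
    have hs : MeasurableSet {x | (l, x) ∈ E} := measurable_prodMk_left hE
    have : (fun x => E.indicator (fun q : ℝ × ℝ => φ q.1) (l, x)) =
        {x | (l, x) ∈ E}.indicator fun _ => φ l := by
      ext x; simp [indicator]
    rw [this, lintegral_indicator_const hs]
  · have : Measurable (E.indicator fun q : ℝ × ℝ => φ q.1) :=
      (hφ.comp measurable_fst).indicator hE
    exact (this.comp measurable_swap).aemeasurable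

/-- The `A_p^+` condition for two adjacent intervals of arbitrary lengths. -/
theorem IsDualWeight.bound_adjacent (hσ : IsDualWeight p K σ) (hp : 1 < p)
    {a b c d : ℝ} (hbc : b < c) (had : c - b ≤ d) (hbd : b - a ≤ d) :
    (∫⁻ t in Ioc a b, ENNReal.ofReal (σ t ^ (1 - p))) *
      (∫⁻ t in Ioc b c, ENNReal.ofReal (σ t)) ^ (p - 1) ≤ ENNReal.ofReal (K * d ^ p) := by
  refine le_trans ?_ (hσ.bound b d (by linarith))
  have : 0 ≤ p - 1 := by linarith
  gcongr <;> linarith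

/-- If `λ` exceeds all averages of `σ` over intervals starting at `y`, then the mass of `σ` on
`{σ > λ}` is controlled by the length of `{σ > η λ}`: on each component of the shadow `σ` has
average `λ`, and the right half has average at least `λ`, so `A_p^+` prevents `σ` from being
smaller than `η λ` on most of the left half. -/
theorem IsDualWeight.measure_level_le (hσ : IsDualWeight p K σ) (hp : 1 < p) (hK : 0 ≤ K)
    {η : ℝ} (hη : 0 < η) (hηK : η ^ (p - 1) * K ≤ 1 / 2) {y d l : ℝ} (hl : 0 < l)
    (hy : ∀ z ∈ Icc y d, ∫ t in y..z, σ t ≤ l * (z - y)) :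
    (volume.withDensity fun x => ENNReal.ofReal (σ x)) (Ioo y d ∩ {x | l < σ x}) ≤
      ENNReal.ofReal (4 * l) * volume (Ioo y d ∩ {x | η * l < σ x}) := by
  set ν : Measure ℝ := volume.withDensity fun x => ENNReal.ofReal (σ x) with hν
  set G : ℝ → ℝ := fun x => (∫ t in y..x, σ t) - l * x with hGdef
  have hG : Continuous G := continuous_integral_sub_mul hσ.locallyIntegrable y l
  have hint := intervalIntegrable_of_locallyIntegrable hσ.locallyIntegrable
  have hGdiff : ∀ u v, G v - G u = (∫ t in u..v, σ t) - l * (v - u) := by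
    intro u v
    have := intervalIntegral.integral_add_adjacent_intervals (hint y u) (hint u v)
    simp only [hGdef]; linarith
  have hms : MeasurableSet {x | η * l < σ x} := measurableSet_lt measurable_const hσ.measurable
  -- almost every point with `σ x > l` lies in the shadow
  have hae : (Ioo y d ∩ {x | l < σ x} : Set ℝ) ≤ᵐ[volume] shadow G y d := by
    filter_upwards [LocallyIntegrable.ae_hasDerivAt_integral hσ.locallyIntegrable] with x hx hxm
    obtain ⟨hxI, hxl⟩ := hxm
    have hd : HasDerivAt G (σ x - l) x := by
      have h := (hx y).sub ((hasDerivAt_id x).const_mul l)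
      rwa [mul_one] at h
    have hpos : 0 < σ x - l := sub_pos.2 hxl
    have h1 := (hasDerivWithinAt_iff_tendsto_slope' self_notMem_Ioi).1
      (hd.hasDerivWithinAt (s := Ioi x))
    have h2 := (h1.eventually (lt_mem_nhds hpos)).and (Ioc_mem_nhdsGT hxI.2)
    obtain ⟨v, hv, hvI⟩ := h2.exists
    refine ⟨hxI, v, hvI, ?_⟩
    rw [slope_def_field, div_pos_iff_of_pos_right (sub_pos.2 hvI.1)] at hv
    linarith
  have hac : ν ≪ volume := withDensity_absolutelyContinuous _ _
  refine (measure_mono_ae (hac.ae_le hae)).trans ?_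
  have hcomp : ν (shadow G y d) ≤
      (ENNReal.ofReal (4 * l) • volume.restrict {x | η * l < σ x}) (shadow G y d) := by
    refine measure_shadow_le hG fun α β hα hαβ hβ hmax hend => ?_
    have hend' : G β ≤ G α := by
      rcases hend with rfl | h
      · have := hy β ⟨hαβ.le, hβ⟩
        have := hGdiff α β
        linarith
      · exact h
    have hνI : ν (Ioo α β) ≤ ENNReal.ofReal (l * (β - α)) := by
      rw [hν, withDensity_apply _ measurableSet_Ioo,
        Measure.restrict_congr_set Ioo_ae_eq_Ioc,
        setLIntegral_Ioc_eq_ofReal hσ.locallyIntegrable (fun x => (hσ.pos x).le) hαβ.le]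
      have := hGdiff α β
      exact ENNReal.ofReal_le_ofReal (by linarith)
    obtain ⟨h, hh⟩ : ∃ h, h = (β - α) / 2 := ⟨_, rfl⟩
    have hh0 : 0 < h := by rw [hh]; linarith
    set m := α + h with hm
    have hmβ : m + h = β := by rw [hm, hh]; ring
    have hright : ENNReal.ofReal (l * h) ≤ ∫⁻ t in Ioc m (m + h), ENNReal.ofReal (σ t) := by
      rw [setLIntegral_Ioc_eq_ofReal hσ.locallyIntegrable (fun x => (hσ.pos x).le) (by linarith)]
      have h1 := hGdiff m (m + h)
      have h2 := hmax m ⟨by linarith, by linarith⟩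
      rw [hmβ] at h1 ⊢
      refine ENNReal.ofReal_le_ofReal ?_
      have : β - m = h := by linarith
      rw [this] at h1
      linarith
    have hA : (∫⁻ t in Ioc α m, ENNReal.ofReal (σ t ^ (1 - p))) * ENNReal.ofReal ((l * h) ^ (p - 1))
        ≤ ENNReal.ofReal (K * h ^ p) := by
      have := hσ.bound m h hh0
      rw [show m - h = α by rw [hm]; ring] at this
      refine le_trans ?_ this
      rw [← ENNReal.ofReal_rpow_of_pos (by positivity)]
      have : 0 ≤ p - 1 := by linarith
      gcongr
    -- Chebyshev's inequality for `w = σ ^ (1 - p)` on the left half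
    have hcheb : ENNReal.ofReal ((η * l) ^ (1 - p)) * volume (Ioc α m ∩ {x | σ x ≤ η * l}) ≤
        ∫⁻ t in Ioc α m, ENNReal.ofReal (σ t ^ (1 - p)) := by
      have hms' : MeasurableSet {x | σ x ≤ η * l} :=
        measurableSet_le hσ.measurable measurable_const
      calc _ = ∫⁻ t in Ioc α m ∩ {x | σ x ≤ η * l}, ENNReal.ofReal ((η * l) ^ (1 - p)) := by
            rw [setLIntegral_const]
        _ ≤ ∫⁻ t in Ioc α m ∩ {x | σ x ≤ η * l}, ENNReal.ofReal (σ t ^ (1 - p)) := by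
            refine setLIntegral_mono' (measurableSet_Ioc.inter hms') fun t ht => ?_
            exact ENNReal.ofReal_le_ofReal
              (Real.rpow_le_rpow_of_nonpos (hσ.pos t) ht.2 (by linarith))
        _ ≤ _ := lintegral_mono_set inter_subset_left
    have hbad : volume (Ioc α m ∩ {x | σ x ≤ η * l}) ≤ ENNReal.ofReal (h / 2) := by
      have h3 : ENNReal.ofReal ((η * l) ^ (1 - p) * (l * h) ^ (p - 1)) *
          volume (Ioc α m ∩ {x | σ x ≤ η * l}) ≤ ENNReal.ofReal (K * h ^ p) := by
        refine le_trans ?_ hA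
        rw [ENNReal.ofReal_mul (by positivity), mul_right_comm]
        gcongr
      have hfin : volume (Ioc α m ∩ {x | σ x ≤ η * l}) ≠ ∞ :=
        ne_top_of_le_ne_top (by simp) (measure_mono inter_subset_left)
      rw [← ENNReal.ofReal_toReal hfin] at h3 ⊢
      set v := (volume (Ioc α m ∩ {x | σ x ≤ η * l})).toReal
      rw [← ENNReal.ofReal_mul (by positivity), ENNReal.ofReal_le_ofReal_iff (by positivity)] at h3
      refine ENNReal.ofReal_le_ofReal ?_
      have e1 : (η * l) ^ (1 - p) * (l * h) ^ (p - 1) = η ^ (1 - p) * h ^ (p - 1) := by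
        rw [Real.mul_rpow hη.le hl.le, Real.mul_rpow hl.le hh0.le,
          show 1 - p = -(p - 1) by ring, Real.rpow_neg hl.le]
        have : l ^ (p - 1) ≠ 0 := by positivity
        field_simp
      have e2 : h ^ p = h ^ (p - 1) * h := by
        rw [← Real.rpow_add_one hh0.ne']; ring_nf
      rw [e1, e2, show 1 - p = -(p - 1) by ring, Real.rpow_neg hη.le] at h3
      have hq1 : 0 < η ^ (p - 1) := by positivity
      have hq2 : 0 < h ^ (p - 1) := by positivity
      have h4 : (η ^ (p - 1))⁻¹ * v ≤ K * h := by
        refine le_of_mul_le_mul_right ?_ hq2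
        calc _ = (η ^ (p - 1))⁻¹ * h ^ (p - 1) * v := by ring
          _ ≤ _ := h3
          _ = _ := by ring
      have h5 : v ≤ η ^ (p - 1) * (K * h) := by
        rwa [inv_mul_le_iff₀ hq1] at h4
      nlinarith
    have hgood : ENNReal.ofReal (h / 2) ≤ volume (Ioo α β ∩ {x | η * l < σ x}) := by
      have h6 : ENNReal.ofReal h ≤ volume (Ioc α m ∩ {x | σ x ≤ η * l}) +
          volume (Ioc α m ∩ {x | η * l < σ x}) := by
        calc ENNReal.ofReal h = volume (Ioc α m) := by
              rw [Real.volume_Ioc]; congr 1; rw [hm]; ring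
          _ ≤ volume (Ioc α m ∩ {x | σ x ≤ η * l} ∪ Ioc α m ∩ {x | η * l < σ x}) := by
              refine measure_mono fun t ht => ?_
              rcases le_or_gt (σ t) (η * l) with h | h
              · exact Or.inl ⟨ht, h⟩
              · exact Or.inr ⟨ht, h⟩
          _ ≤ _ := measure_union_le _ _
      have h7 : volume (Ioc α m ∩ {x | η * l < σ x}) ≤ volume (Ioo α β ∩ {x | η * l < σ x}) := by
        refine measure_mono (inter_subset_inter_left _ fun t ht => ⟨ht.1, ?_⟩)
        linarith [ht.2]
      have h8 : ENNReal.ofReal h = ENNReal.ofReal (h / 2) + ENNReal.ofReal (h / 2) := by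
        rw [← ENNReal.ofReal_add (by positivity) (by positivity)]; ring_nf
      rw [h8] at h6
      refine le_trans ?_ h7
      refine (ENNReal.add_le_add_iff_left ENNReal.ofReal_ne_top).1 (h6.trans ?_)
      gcongr
    calc ν (Ioo α β) ≤ ENNReal.ofReal (l * (β - α)) := hνI
      _ = ENNReal.ofReal (4 * l) * ENNReal.ofReal (h / 2) := by
          rw [← ENNReal.ofReal_mul (by positivity), hh]; ring_nf
      _ ≤ ENNReal.ofReal (4 * l) * volume (Ioo α β ∩ {x | η * l < σ x}) := by gcongr
      _ = _ := by
          rw [Measure.smul_apply, smul_eq_mul, Measure.restrict_apply measurableSet_Ioo]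
  refine hcomp.trans ?_
  rw [Measure.smul_apply, smul_eq_mul,
    Measure.restrict_apply (isOpen_shadow hG y d).measurableSet]
  gcongr
  exact shadow_subset_Ioo G y d

theorem lintegral_Ioo_mul_rpow {a t δ : ℝ} (ha : 0 ≤ a) (hat : a ≤ t) (hδ : 0 < δ) :
    ∫⁻ l in Ioo a t, ENNReal.ofReal (δ * l ^ (δ - 1)) = ENNReal.ofReal (t ^ δ - a ^ δ) := by
  have hint : ∫ l in a..t, δ * l ^ (δ - 1) = t ^ δ - a ^ δ := by
    rw [intervalIntegral.integral_const_mul, integral_rpow (Or.inl (by linarith))]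
    simp only [sub_add_cancel]
    field_simp
  have hii : IntervalIntegrable (fun l => δ * l ^ (δ - 1)) volume a t :=
    (intervalIntegral.intervalIntegrable_rpow' (by linarith)).const_mul δ
  rw [Measure.restrict_congr_set Ioo_ae_eq_Ioc, ← ofReal_integral_eq_lintegral_ofReal
    ((intervalIntegrable_iff_integrableOn_Ioc_of_le hat).1 hii), ←
    intervalIntegral.integral_of_le hat, hint]
  filter_upwards [ae_restrict_mem measurableSet_Ioc] with l hl
  have : 0 < l := ha.trans_lt hl.1
  positivity

theorem ofReal_rpow_le_add_lintegral {a t δ : ℝ} (ha : 0 ≤ a) (ht : 0 ≤ t) (hδ : 0 < δ) :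
    ENNReal.ofReal (t ^ δ) ≤
      ENNReal.ofReal (a ^ δ) + ∫⁻ l in Ioo a t, ENNReal.ofReal (δ * l ^ (δ - 1)) := by
  rcases le_or_gt t a with h | h
  · exact le_add_right (ENNReal.ofReal_le_ofReal (Real.rpow_le_rpow ht h hδ.le))
  · rw [lintegral_Ioo_mul_rpow ha h.le hδ, ← ENNReal.ofReal_add (by positivity)
      (sub_nonneg.2 (Real.rpow_le_rpow ha h.le hδ.le))]
    exact ENNReal.ofReal_le_ofReal (by linarith)

theorem IsDualWeight.lintegral_Ioo_lt_top (hσ : IsDualWeight p K σ) (a b : ℝ) :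
    ∫⁻ t in Ioo a b, ENNReal.ofReal (σ t) < ∞ := by
  refine lt_of_le_of_lt (lintegral_mono_set Ioo_subset_Icc_self) ?_
  exact (hσ.locallyIntegrable.integrableOn_isCompact
    (isCompact_Icc (a := a) (b := b))).lintegral_lt_top

/-- The truncated form of the reverse Hölder inequality, where all quantities are finite and the
term on the right can be absorbed. -/
theorem IsDualWeight.reverse_holder_trunc (hσ : IsDualWeight p K σ) (hp : 1 < p) (hK : 0 ≤ K)
    {η δ : ℝ} (hη : 0 < η) (hη1 : η ≤ 1) (hηK : η ^ (p - 1) * K ≤ 1 / 2) (hδ : 0 < δ)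
    (hδη : 8 * δ ≤ η ^ (1 + δ)) {y d l₀ : ℝ} (hl₀ : 0 < l₀)
    (hy : ∀ z ∈ Icc y d, ∫ t in y..z, σ t ≤ l₀ * (z - y)) {N : ℝ} (hN : 0 < N) :
    ∫⁻ t in Ioo y d, ENNReal.ofReal (min (σ t) N ^ δ * σ t) ≤
      2 * ENNReal.ofReal (l₀ ^ δ) * ∫⁻ t in Ioo y d, ENNReal.ofReal (σ t) := by
  set A := Ioo y d with hA
  have hAm : MeasurableSet A := measurableSet_Ioo
  set ν : Measure ℝ := volume.withDensity fun x => ENNReal.ofReal (σ x) with hν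
  have hσm := hσ.measurable
  have hmin : ∀ t, 0 < min (σ t) N := fun t => lt_min (hσ.pos t) hN
  have hνA : ν A = ∫⁻ t in A, ENNReal.ofReal (σ t) := withDensity_apply _ hAm
  have hνfin : ν A < ∞ := hνA ▸ hσ.lintegral_Ioo_lt_top y d
  set X := ∫⁻ t in A, ENNReal.ofReal (min (σ t) N ^ δ * σ t) with hX
  have hXν : X = ∫⁻ t in A, ENNReal.ofReal (min (σ t) N ^ δ) ∂ν := by
    rw [hν, restrict_withDensity hAm, lintegral_withDensity_eq_lintegral_mul]
    · refine lintegral_congr fun t => ?_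
      rw [Pi.mul_apply, ← ENNReal.ofReal_mul (hσ.pos t).le, mul_comm]
    · exact hσm.ennreal_ofReal
    · exact ((hσm.min measurable_const).pow_const δ).ennreal_ofReal
  have hXfin : X ≠ ∞ := by
    rw [hXν]
    refine ne_top_of_le_ne_top (b := ENNReal.ofReal (N ^ δ) * ν A)
      (ENNReal.mul_ne_top ENNReal.ofReal_ne_top hνfin.ne) ?_
    rw [← setLIntegral_const]
    refine lintegral_mono fun t => ENNReal.ofReal_le_ofReal ?_
    exact Real.rpow_le_rpow (hmin t).le (min_le_right _ _) hδ.le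
  have hsfin : SFinite ν := by rw [hν]; infer_instance
  have hE : ∀ c : ℝ, MeasurableSet {q : ℝ × ℝ | c * q.1 < σ q.2} := fun c =>
    measurableSet_lt (measurable_const.mul measurable_fst) (hσm.comp measurable_snd)
  have hφ : Measurable fun l : ℝ => ENNReal.ofReal (δ * l ^ (δ - 1)) :=
    ((measurable_id.pow_const _).const_mul _).ennreal_ofReal
  have hφ' : Measurable fun l : ℝ => ENNReal.ofReal (4 * δ * l ^ δ) :=
    ((measurable_id.pow_const _).const_mul _).ennreal_ofReal
  -- layer cake for `σ` with respect to the measure `σ dx`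
  have step1 : X ≤ ENNReal.ofReal (l₀ ^ δ) * ν A +
      ∫⁻ l in Ioo l₀ N, ENNReal.ofReal (δ * l ^ (δ - 1)) * ν (A ∩ {x | l < σ x}) := by
    have h1 : ∀ l, ν (A ∩ {x | l < σ x}) =
        (ν.restrict A) {x | (l, x) ∈ {q : ℝ × ℝ | 1 * q.1 < σ q.2}} := by
      intro l
      rw [Measure.restrict_apply' hAm, inter_comm]
      simp
    simp_rw [h1]
    rw [lintegral_mul_measure_section (hE 1) _ hφ, hXν, ← setLIntegral_const,
      ← lintegral_add_left measurable_const]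
    refine lintegral_mono fun t => ?_
    refine (ofReal_rpow_le_add_lintegral hl₀.le (hmin t).le hδ).trans ?_
    refine add_le_add_right ?_ _
    rw [← lintegral_indicator measurableSet_Ioo, ← lintegral_indicator measurableSet_Ioo]
    refine lintegral_mono fun l => ?_
    by_cases hl : l ∈ Ioo l₀ (min (σ t) N)
    · have h2 : l ∈ Ioo l₀ N := ⟨hl.1, hl.2.trans_le (min_le_right _ _)⟩
      have h3 : (l, t) ∈ {q : ℝ × ℝ | 1 * q.1 < σ q.2} := by
        simpa using hl.2.trans_le (min_le_left _ _)
      simp only [indicator_of_mem hl, indicator_of_mem h2, indicator_of_mem h3, le_refl]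
    · simp [indicator_of_notMem hl]
  have step2 : ∫⁻ l in Ioo l₀ N, ENNReal.ofReal (δ * l ^ (δ - 1)) * ν (A ∩ {x | l < σ x}) ≤
      ∫⁻ l in Ioo l₀ N, ENNReal.ofReal (4 * δ * l ^ δ) * volume (A ∩ {x | η * l < σ x}) := by
    refine setLIntegral_mono' measurableSet_Ioo fun l hl => ?_
    have hl0 : 0 < l := hl₀.trans hl.1
    have := hσ.measure_level_le hp hK hη hηK hl0 (y := y) (d := d) fun z hz =>
      (hy z hz).trans (mul_le_mul_of_nonneg_right hl.1.le (sub_nonneg.2 hz.1))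
    calc _ ≤ ENNReal.ofReal (δ * l ^ (δ - 1)) *
          (ENNReal.ofReal (4 * l) * volume (A ∩ {x | η * l < σ x})) := by gcongr
      _ = _ := by
        rw [← mul_assoc, ← ENNReal.ofReal_mul (by positivity)]
        congr 2
        rw [show δ * l ^ (δ - 1) * (4 * l) = 4 * δ * (l ^ (δ - 1) * l) by ring,
          ← Real.rpow_add_one hl0.ne']
        simp
  have step3 : ∫⁻ l in Ioo l₀ N, ENNReal.ofReal (4 * δ * l ^ δ) * volume (A ∩ {x | η * l < σ x})
      ≤ ENNReal.ofReal (1 / 2) * X := by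
    have h1 : ∀ l, volume (A ∩ {x | η * l < σ x}) =
        (volume.restrict A) {x | (l, x) ∈ {q : ℝ × ℝ | η * q.1 < σ q.2}} := by
      intro l
      rw [Measure.restrict_apply' hAm, inter_comm]
      simp
    simp_rw [h1]
    rw [lintegral_mul_measure_section (hE η) _ hφ', hX,
      ← lintegral_const_mul' _ _ ENNReal.ofReal_ne_top]
    refine lintegral_mono fun t => ?_
    rw [← lintegral_indicator measurableSet_Ioo]
    set T := min (σ t) N / η with hT
    have hT0 : 0 < T := div_pos (hmin t) hη
    calc _ ≤ ∫⁻ l, (Ioo 0 T).indicator (fun _ => ENNReal.ofReal (4 * δ * T ^ δ)) l := by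
          refine lintegral_mono fun l => ?_
          by_cases hl : l ∈ Ioo l₀ N ∧ η * l < σ t
          · have hl0 : 0 < l := hl₀.trans hl.1.1
            have h4 : l < T := by
              rw [hT, lt_div_iff₀ hη, lt_min_iff]
              refine ⟨by rw [mul_comm]; exact hl.2, ?_⟩
              nlinarith [hl.1.2]
            have h3 : (l, t) ∈ {q : ℝ × ℝ | η * q.1 < σ q.2} := hl.2
            simp only [indicator_of_mem hl.1, indicator_of_mem h3,
              indicator_of_mem (show l ∈ Ioo 0 T from ⟨hl0, h4⟩)]
            gcongr
          · rw [not_and_or] at hl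
            rcases hl with hl | hl
            · simp [indicator_of_notMem hl]
            · have h3 : (l, t) ∉ {q : ℝ × ℝ | η * q.1 < σ q.2} := hl
              by_cases hl' : l ∈ Ioo l₀ N
              · simp only [indicator_of_mem hl', indicator_of_notMem h3, zero_le]
              · simp only [indicator_of_notMem hl', zero_le]
      _ = ENNReal.ofReal (4 * δ * T ^ δ * T) := by
          rw [lintegral_indicator_const measurableSet_Ioo, Real.volume_Ioo, sub_zero,
            ← ENNReal.ofReal_mul (by positivity)]
      _ ≤ _ := by
          rw [← ENNReal.ofReal_mul (by positivity)]
          refine ENNReal.ofReal_le_ofReal ?_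
          have e1 : T ^ δ = min (σ t) N ^ δ / η ^ δ := Real.div_rpow (hmin t).le hη.le δ
          have e2 : η ^ (1 + δ) = η * η ^ δ := by rw [add_comm, Real.rpow_add_one hη.ne', mul_comm]
          have hq : 0 < η ^ δ := by positivity
          have hm := hmin t
          rw [e1, hT]
          have e3 : 4 * δ * (min (σ t) N ^ δ / η ^ δ) * (min (σ t) N / η) =
              (4 * δ / η ^ (1 + δ)) * (min (σ t) N ^ δ * min (σ t) N) := by
            rw [e2]; field_simp
          rw [e3]
          have h5 : 4 * δ / η ^ (1 + δ) ≤ 1 / 2 := by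
            rw [div_le_iff₀ (by positivity)]; linarith
          gcongr
          exact min_le_left _ _
  have step4 : X ≤ ENNReal.ofReal (l₀ ^ δ) * ν A + ENNReal.ofReal (1 / 2) * X :=
    step1.trans (add_le_add_right (step2.trans step3) _)
  have hXX : X = ENNReal.ofReal (1 / 2) * X + ENNReal.ofReal (1 / 2) * X := by
    rw [← add_mul, ← ENNReal.ofReal_add (by norm_num) (by norm_num)]; norm_num
  have hhalf : ENNReal.ofReal (1 / 2) * X ≤ ENNReal.ofReal (l₀ ^ δ) * ν A := by
    refine (ENNReal.add_le_add_iff_right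
      (ENNReal.mul_ne_top (ENNReal.ofReal_ne_top (r := 1 / 2)) hXfin)).1 ?_
    exact hXX.symm.trans_le step4
  rw [← hνA, mul_assoc, two_mul]
  exact hXX.trans_le (add_le_add hhalf hhalf)

/-- A one-sided reverse Hölder inequality with a gain of integrability `δ` of the order of
`K ^ (-1 / (p - 1))`. -/
theorem IsDualWeight.reverse_holder (hσ : IsDualWeight p K σ) (hp : 1 < p) (hK : 0 ≤ K)
    {η δ : ℝ} (hη : 0 < η) (hη1 : η ≤ 1) (hηK : η ^ (p - 1) * K ≤ 1 / 2) (hδ : 0 < δ)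
    (hδη : 8 * δ ≤ η ^ (1 + δ)) {y d l₀ : ℝ} (hl₀ : 0 < l₀)
    (hy : ∀ z ∈ Icc y d, ∫ t in y..z, σ t ≤ l₀ * (z - y)) :
    ∫⁻ t in Ioo y d, ENNReal.ofReal (σ t ^ (1 + δ)) ≤
      2 * ENNReal.ofReal (l₀ ^ δ) * ∫⁻ t in Ioo y d, ENNReal.ofReal (σ t) := by
  have hUn : Ioo y d = ⋃ N : ℕ, Ioo y d ∩ {t | σ t ≤ (N : ℝ) + 1} := by
    rw [← inter_iUnion]
    refine (inter_eq_left.2 fun t _ => ?_).symm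
    obtain ⟨n, hn⟩ := exists_nat_ge (σ t)
    exact mem_iUnion.2 ⟨n, hn.trans (by simp)⟩
  have hdir : Directed (· ⊆ ·) fun N : ℕ => Ioo y d ∩ {t | σ t ≤ (N : ℝ) + 1} := by
    refine Monotone.directed_le fun m n hmn => inter_subset_inter_right _ fun t ht => ?_
    exact le_trans (show σ t ≤ (m : ℝ) + 1 from ht) (by gcongr)
  conv_lhs => rw [hUn]
  rw [setLIntegral_iUnion_of_directed _ hdir]
  refine iSup_le fun N => ?_
  refine le_trans ?_ (hσ.reverse_holder_trunc hp hK hη hη1 hηK hδ hδη hl₀ hy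
    (N := (N : ℝ) + 1) (by positivity))
  refine le_trans (setLIntegral_mono' (measurableSet_Ioo.inter
    (measurableSet_le hσ.measurable measurable_const)) fun t ht => ?_)
    (lintegral_mono_set inter_subset_left)
  rw [min_eq_left ht.2, add_comm, Real.rpow_add_one (hσ.pos t).ne']

/-! ### Openness of the one-sided condition, for separated intervals -/

/-- The `A_s^+` condition with `s - 1 = (p - 1) / (1 + δ)` for intervals `(a, b]` and `(c, d]`
separated by a gap of comparable length. The gap leaves room for a point `y ∈ [b, c]` such that
all averages of `σ` over intervals starting at `y` are at most `∫_b^d σ / (c - b)`, and the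
reverse Hölder inequality is applied on `(y, d)`. -/
theorem IsDualWeight.gap_bound (hσ : IsDualWeight p K σ) (hp : 1 < p) (hK : 0 ≤ K)
    {η δ : ℝ} (hη : 0 < η) (hη1 : η ≤ 1) (hηK : η ^ (p - 1) * K ≤ 1 / 2) (hδ : 0 < δ)
    (hδη : 8 * δ ≤ η ^ (1 + δ)) {s : ℝ} (hs : (s - 1) * (1 + δ) = p - 1)
    {a b c d : ℝ} (hab : a < b) (hbc : b < c) (hcd : c < d) (hgap : d - a ≤ 4 * (c - b)) :
    (∫⁻ t in Ioc a b, ENNReal.ofReal (σ t ^ (1 - p))) *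
      (∫⁻ t in Ioc c d, ENNReal.ofReal (σ t ^ (1 + δ))) ^ (s - 1) ≤
      ENNReal.ofReal (8 ^ p * K * (d - a) ^ s) := by
  have hs1 : 0 < s - 1 := by
    by_contra! h
    nlinarith
  have hsp : 0 ≤ p - s := by nlinarith
  have hint := intervalIntegrable_of_locallyIntegrable hσ.locallyIntegrable
  have hbd : b < d := hbc.trans hcd
  set I := ∫ t in b..d, σ t with hI
  have hI0 : 0 < I := intervalIntegral.intervalIntegral_pos_of_pos (hint b d) hσ.pos hbd
  have hcb : 0 < c - b := sub_pos.2 hbc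
  set l₀ := I / (c - b) with hl₀def
  have hl₀ : 0 < l₀ := div_pos hI0 hcb
  have hlI : l₀ * (c - b) = I := div_mul_cancel₀ _ hcb.ne'
  obtain ⟨y, hyI, hmax⟩ := (isCompact_Icc (a := b) (b := d)).exists_isMaxOn
    ⟨b, le_rfl, hbd.le⟩ (continuous_integral_sub_mul hσ.locallyIntegrable b l₀).continuousOn
  have hadj := fun u v => intervalIntegral.integral_add_adjacent_intervals (hint b u) (hint u v)
  have hnn : ∀ u v, u ≤ v → 0 ≤ ∫ t in u..v, σ t := fun u v huv =>
    intervalIntegral.integral_nonneg huv fun t _ => (hσ.pos t).le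
  have hyc : y ≤ c := by
    by_contra! hlt
    have h1 := hmax (show b ∈ Icc b d from ⟨le_rfl, hbd.le⟩)
    simp only [mem_ofPred_eq, intervalIntegral.integral_same] at h1
    have h2 := hadj y d
    have h3 := hnn y d hyI.2
    nlinarith
  have hy : ∀ z ∈ Icc y d, ∫ t in y..z, σ t ≤ l₀ * (z - y) := by
    intro z hz
    have h1 := hmax (show z ∈ Icc b d from ⟨hyI.1.trans hz.1, hz.2⟩)
    simp only [mem_ofPred_eq] at h1
    have h2 := hadj y z
    linarith
  have hS : ∫⁻ t in Ioc c d, ENNReal.ofReal (σ t ^ (1 + δ)) ≤ ENNReal.ofReal (2 * l₀ ^ δ * I) := by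
    calc _ = ∫⁻ t in Ioo c d, ENNReal.ofReal (σ t ^ (1 + δ)) := by
          rw [Measure.restrict_congr_set Ioo_ae_eq_Ioc]
      _ ≤ ∫⁻ t in Ioo y d, ENNReal.ofReal (σ t ^ (1 + δ)) :=
          lintegral_mono_set (Ioo_subset_Ioo_left hyc)
      _ ≤ 2 * ENNReal.ofReal (l₀ ^ δ) * ∫⁻ t in Ioo y d, ENNReal.ofReal (σ t) :=
          hσ.reverse_holder hp hK hη hη1 hηK hδ hδη hl₀ hy
      _ ≤ 2 * ENNReal.ofReal (l₀ ^ δ) * ∫⁻ t in Ioc b d, ENNReal.ofReal (σ t) := by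
          gcongr
          exact fun t ht => ⟨hyI.1.trans_lt ht.1, ht.2.le⟩
      _ = _ := by
          rw [setLIntegral_Ioc_eq_ofReal hσ.locallyIntegrable (fun x => (hσ.pos x).le) hbd.le,
            ENNReal.ofReal_mul (by positivity), ENNReal.ofReal_mul (by norm_num),
            ENNReal.ofReal_ofNat]
  have hA := hσ.bound_adjacent hp (a := a) (b := b) (c := d) (d := d - a) hbd
    (by linarith) (by linarith)
  rw [setLIntegral_Ioc_eq_ofReal hσ.locallyIntegrable (fun x => (hσ.pos x).le) hbd.le,
    ENNReal.ofReal_rpow_of_pos hI0] at hA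
  have e1 : (2 * l₀ ^ δ * I) ^ (s - 1) = 2 ^ (s - 1) * (c - b) ^ (-(p - s)) * I ^ (p - 1) := by
    rw [hl₀def, Real.div_rpow hI0.le hcb.le, Real.mul_rpow (by positivity) hI0.le,
      Real.mul_rpow (by norm_num) (by positivity), Real.div_rpow (by positivity) (by positivity),
      ← Real.rpow_mul hI0.le, ← Real.rpow_mul hcb.le, Real.rpow_neg hcb.le,
      show p - s = δ * (s - 1) by linarith, show p - 1 = δ * (s - 1) + (s - 1) by linarith,
      Real.rpow_add hI0]
    field_simp
  have hda : 0 < d - a := by linarith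
  have e2 : 2 ^ (s - 1) * (c - b) ^ (-(p - s)) * (K * (d - a) ^ p) ≤ 8 ^ p * K * (d - a) ^ s := by
    have h1 : (c - b) ^ (-(p - s)) ≤ ((d - a) / 4) ^ (-(p - s)) :=
      Real.rpow_le_rpow_of_nonpos (by positivity) (by linarith) (by linarith)
    have h2 : ((d - a) / 4) ^ (-(p - s)) = 4 ^ (p - s) * (d - a) ^ (-(p - s)) := by
      rw [Real.div_rpow hda.le (by norm_num), Real.rpow_neg (by norm_num : (0:ℝ) ≤ 4)]
      field_simp
    have h3 : (d - a) ^ (-(p - s)) * (d - a) ^ p = (d - a) ^ s := by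
      rw [← Real.rpow_add hda]; ring_nf
    have h4 : (2 : ℝ) ^ (s - 1) ≤ 2 ^ p :=
      Real.rpow_le_rpow_of_exponent_le (by norm_num) (by linarith)
    have h5 : (4 : ℝ) ^ (p - s) ≤ 4 ^ p :=
      Real.rpow_le_rpow_of_exponent_le (by norm_num) (by linarith)
    have h6 : (2 : ℝ) ^ p * 4 ^ p = 8 ^ p := by
      rw [← Real.mul_rpow (by norm_num) (by norm_num)]; norm_num
    calc _ ≤ 2 ^ (s - 1) * (4 ^ (p - s) * (d - a) ^ (-(p - s))) * (K * (d - a) ^ p) := by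
          rw [← h2]; gcongr
      _ = 2 ^ (s - 1) * 4 ^ (p - s) * K * ((d - a) ^ (-(p - s)) * (d - a) ^ p) := by ring
      _ ≤ 2 ^ p * 4 ^ p * K * (d - a) ^ s := by rw [h3]; gcongr
      _ = _ := by rw [h6]
  calc _ ≤ (∫⁻ t in Ioc a b, ENNReal.ofReal (σ t ^ (1 - p))) *
        ENNReal.ofReal ((2 * l₀ ^ δ * I) ^ (s - 1)) := by
        rw [← ENNReal.ofReal_rpow_of_pos (by positivity)]
        gcongr
    _ = ENNReal.ofReal (2 ^ (s - 1) * (c - b) ^ (-(p - s))) *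
        ((∫⁻ t in Ioc a b, ENNReal.ofReal (σ t ^ (1 - p))) * ENNReal.ofReal (I ^ (p - 1))) := by
        rw [e1, ENNReal.ofReal_mul (by positivity)]; ring
    _ ≤ ENNReal.ofReal (2 ^ (s - 1) * (c - b) ^ (-(p - s))) * ENNReal.ofReal (K * (d - a) ^ p) := by
        gcongr
    _ ≤ _ := by
        rw [← ENNReal.ofReal_mul (by positivity)]
        exact ENNReal.ofReal_le_ofReal e2

/-- Hölder's inequality with the weight `w = σ ^ (1 - p)`. -/
theorem rpow_setLIntegral_le (hσm : Measurable σ) (hpos : ∀ x, 0 < σ x) {δ s : ℝ} (hs1 : 1 < s)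
    (hs : (s - 1) * (1 + δ) = p - 1) {f : ℝ → ℝ≥0∞} (hf : Measurable f) (S : Set ℝ) :
    (∫⁻ t in S, f t) ^ s ≤ (∫⁻ t in S, f t ^ s * ENNReal.ofReal (σ t ^ (1 - p))) *
      (∫⁻ t in S, ENNReal.ofReal (σ t ^ (1 + δ))) ^ (s - 1) := by
  have hs0 : 0 < s := by linarith
  have hs10 : 0 < s - 1 := by linarith
  have hc : s.HolderConjugate (s / (s - 1)) := Real.HolderConjugate.conjExponent hs1
  have hU : Measurable fun t => ENNReal.ofReal (σ t ^ ((1 - p) / s)) :=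
    (hσm.pow_const _).ennreal_ofReal
  have hV : Measurable fun t => ENNReal.ofReal (σ t ^ ((p - 1) / s)) :=
    (hσm.pow_const _).ennreal_ofReal
  have h := ENNReal.lintegral_mul_le_Lp_mul_Lq (volume.restrict S) hc
    (hf.mul hU).aemeasurable hV.aemeasurable
  have e0 : ∀ t, ((f * fun t => ENNReal.ofReal (σ t ^ ((1 - p) / s))) *
      fun t => ENNReal.ofReal (σ t ^ ((p - 1) / s))) t = f t := by
    intro t
    have hq := hpos t
    simp only [Pi.mul_apply]
    rw [mul_assoc, ← ENNReal.ofReal_mul (by positivity), ← Real.rpow_add hq,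
      show (1 - p) / s + (p - 1) / s = 0 by ring]
    simp
  have e1 : ∀ t, (f * fun t => ENNReal.ofReal (σ t ^ ((1 - p) / s))) t ^ s =
      f t ^ s * ENNReal.ofReal (σ t ^ (1 - p)) := by
    intro t
    have hq := hpos t
    rw [Pi.mul_apply, ENNReal.mul_rpow_of_nonneg _ _ hs0.le,
      ENNReal.ofReal_rpow_of_pos (by positivity), ← Real.rpow_mul hq.le, div_mul_cancel₀ _ hs0.ne']
  have e2 : ∀ t, ENNReal.ofReal (σ t ^ ((p - 1) / s)) ^ (s / (s - 1)) =
      ENNReal.ofReal (σ t ^ (1 + δ)) := by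
    intro t
    have hq := hpos t
    rw [ENNReal.ofReal_rpow_of_pos (by positivity), ← Real.rpow_mul hq.le, ← hs]
    congr 2
    field_simp
  simp_rw [e0, e1, e2] at h
  calc _ ≤ _ := ENNReal.rpow_le_rpow h hs0.le
    _ = _ := by
      rw [ENNReal.mul_rpow_of_nonneg _ _ hs0.le, ← ENNReal.rpow_mul, ← ENNReal.rpow_mul]
      congr 2
      · rw [one_div_mul_cancel hs0.ne', ENNReal.rpow_one]
      · field_simp

/-! ### The weak type inequality on a component of the shadow -/

/-- The passage from separated to adjacent intervals. The interval is decomposed into pieces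
`[t_k, t_{k+1})` halving the distance to `β`, and the measure of such a piece is compared with that
of `(t_{k+2}, y_k]`, which carries half the mass of `g` on `(t_{k+2}, β)`. The intervals
`(t_{k+2}, y_k]` overlap, but at each point the coefficients of the comparison decay
geometrically. -/
theorem measure_Ioo_le_of_gap {μ Φ : Measure ℝ} {g : ℝ → ℝ} (hg : LocallyIntegrable g volume)
    (hg0 : ∀ x, 0 ≤ g x) {A s : ℝ} (hA : 0 ≤ A) (hs : 1 ≤ s)
    (hgap : ∀ a b c d : ℝ, a < b → b < c → c < d → d - a ≤ 4 * (c - b) →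
      μ (Ico a b) * (∫⁻ t in Ioc c d, ENNReal.ofReal (g t)) ^ s ≤
        ENNReal.ofReal (A * (d - a) ^ s) * Φ (Ioc c d))
    {α β l : ℝ} (hαβ : α < β) (hl : 0 < l)
    (hav : ∀ x ∈ Icc α β, l * (β - x) ≤ ∫ t in x..β, g t) :
    μ (Ioo α β) ≤ ENNReal.ofReal (2 * A * (16 / l) ^ s) * Φ (Ioo α β) := by
  have hs0 : 0 < s := by linarith
  have hint := intervalIntegrable_of_locallyIntegrable hg
  set F : ℝ → ℝ := fun x => ∫ t in x..β, g t with hF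
  have hadd : ∀ u v, F u = (∫ t in u..v, g t) + F v := fun u v =>
    (intervalIntegral.integral_add_adjacent_intervals (hint u v) (hint v β)).symm
  have hanti : ∀ u v, u ≤ v → F v ≤ F u := fun u v huv => by
    rw [hadd u v]
    linarith [intervalIntegral.integral_nonneg (μ := volume) huv fun t _ => hg0 t]
  have hFc : Continuous F := by
    have : F = fun x => -∫ t in β..x, g t := by
      ext x; exact intervalIntegral.integral_symm _ _
    rw [this]
    exact (intervalIntegral.continuous_primitive hint β).neg
  have hFβ : F β = 0 := intervalIntegral.integral_same
  set L := β - α with hL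
  have hL0 : 0 < L := sub_pos.2 hαβ
  set t : ℕ → ℝ := fun k => β - (1 / 2) ^ k * L with ht
  have hpow : ∀ k : ℕ, (0 : ℝ) < (1 / 2) ^ k := fun k => by positivity
  have hpow1 : ∀ k : ℕ, ((1 : ℝ) / 2) ^ k ≤ 1 := fun k =>
    pow_le_one₀ (by norm_num) (by norm_num)
  have htα : ∀ k, α ≤ t k := fun k => by
    have := mul_le_mul_of_nonneg_right (hpow1 k) hL0.le
    simp only [ht]; linarith
  have htβ : ∀ k, t k < β := fun k => by
    have := mul_pos (hpow k) hL0
    simp only [ht]; linarith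
  have hFk : ∀ k, l * ((1 / 2) ^ k * L) ≤ F (t k) := fun k => by
    have := hav (t k) ⟨htα k, (htβ k).le⟩
    simpa [ht] using this
  have hFpos : ∀ k, 0 < F (t k) := fun k =>
    lt_of_lt_of_le (mul_pos hl (mul_pos (hpow k) hL0)) (hFk k)
  have hy : ∀ k, ∃ y, t (k + 2) < y ∧ y < β ∧ F y = F (t (k + 2)) / 2 := by
    intro k
    have hpos := hFpos (k + 2)
    obtain ⟨y, hyI, hy⟩ := intermediate_value_Icc' (htβ (k + 2)).le hFc.continuousOn
      (show F (t (k + 2)) / 2 ∈ Icc (F β) (F (t (k + 2))) from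
        ⟨by rw [hFβ]; linarith, by linarith⟩)
    refine ⟨y, lt_of_le_of_ne hyI.1 ?_, lt_of_le_of_ne hyI.2 ?_, hy⟩
    · rintro rfl; linarith
    · rintro rfl; linarith
  choose y hy1 hy2 hy3 using hy
  set c : ℕ → ℝ := fun k => A * (2 * ((1 / 2) ^ k * L) / F (t (k + 2))) ^ s with hc
  have hpiece : ∀ k, μ (Ico (t k) (t (k + 1))) ≤
      ENNReal.ofReal (c k) * Φ (Ioc (t (k + 2)) (y k)) := by
    intro k
    have hpos := hFpos (k + 2)
    have hkL := mul_pos (hpow k) hL0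
    have e1 : t (k + 1) = β - (1 / 2) ^ k * L / 2 := by simp only [ht, pow_succ]; ring
    have e2 : t (k + 2) = β - (1 / 2) ^ k * L / 4 := by simp only [ht, pow_succ]; ring
    have e0 : t k = β - (1 / 2) ^ k * L := rfl
    have h := hgap (t k) (t (k + 1)) (t (k + 2)) (y k) (by linarith) (by linarith) (hy1 k)
      (by linarith [hy2 k])
    have hint2 : ∫ x in t (k + 2)..y k, g x = F (t (k + 2)) / 2 := by
      have := hadd (t (k + 2)) (y k)
      rw [hy3] at this; linarith
    rw [setLIntegral_Ioc_eq_ofReal hg hg0 (hy1 k).le, hint2,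
      ENNReal.ofReal_rpow_of_pos (by positivity)] at h
    set D := (F (t (k + 2)) / 2) ^ s with hD
    have hD0 : 0 < D := by positivity
    have hcD : A * ((1 / 2) ^ k * L) ^ s = c k * D := by
      simp only [hc, hD]
      rw [mul_assoc, ← Real.mul_rpow (by positivity) (by positivity)]
      congr 2
      field_simp
    have hD' : ENNReal.ofReal D ≠ 0 := by simpa using hD0
    refine (ENNReal.mul_le_mul_iff_left hD' ENNReal.ofReal_ne_top).1 (h.trans ?_)
    calc _ ≤ ENNReal.ofReal (A * ((1 / 2) ^ k * L) ^ s) * Φ (Ioc (t (k + 2)) (y k)) := by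
          gcongr
          · linarith [hy1 k]
          · linarith [hy2 k]
      _ = _ := by
          rw [hcD, ENNReal.ofReal_mul (by simp only [hc]; positivity)]; ring
  have hcover : Ioo α β ⊆ ⋃ k, Ico (t k) (t (k + 1)) := by
    intro x hx
    obtain ⟨n, hn1, hn2⟩ := exists_nat_pow_near_of_lt_one (x := (β - x) / L)
      (div_pos (sub_pos.2 hx.2) hL0) (by rw [div_le_one hL0]; linarith [hx.1])
      (show (0 : ℝ) < 1 / 2 by norm_num) (by norm_num)
    rw [lt_div_iff₀ hL0] at hn1
    rw [div_le_iff₀ hL0] at hn2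
    exact mem_iUnion.2 ⟨n, by simp only [ht]; linarith, by simp only [ht]; linarith⟩
  have hpt : ∀ x, ∑' k, (Ioc (t (k + 2)) (y k)).indicator (fun _ => ENNReal.ofReal (c k)) x ≤
      (Ioo α β).indicator (fun _ => ENNReal.ofReal (2 * A * (16 / l) ^ s)) x := by
    intro x
    by_cases hex : ∃ k, x ∈ Ioc (t (k + 2)) (y k)
    · classical
      set k₀ := Nat.find hex with hk₀
      have hk₀m : x ∈ Ioc (t (k₀ + 2)) (y k₀) := Nat.find_spec hex
      have hxI : x ∈ Ioo α β :=
        ⟨(htα _).trans_lt hk₀m.1, hk₀m.2.trans_lt (hy2 k₀)⟩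
      rw [indicator_of_mem hxI, ← ENNReal.summable.sum_add_tsum_nat_add' (k := k₀)]
      have hz : ∑ i ∈ Finset.range k₀,
          (Ioc (t (i + 2)) (y i)).indicator (fun _ => ENNReal.ofReal (c i)) x = 0 :=
        Finset.sum_eq_zero fun i hi =>
          indicator_of_notMem (Nat.find_min hex (Finset.mem_range.1 hi)) _
      rw [hz, zero_add]
      have hFx : l * ((1 / 2) ^ (k₀ + 2) * L) / 2 ≤ F x := by
        have h1 := hanti x (y k₀) hk₀m.2
        have h2 := hFk (k₀ + 2)
        rw [hy3] at h1
        linarith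
      have hterm : ∀ i, (Ioc (t (i + k₀ + 2)) (y (i + k₀))).indicator
          (fun _ => ENNReal.ofReal (c (i + k₀))) x ≤
          ENNReal.ofReal (A * (16 / l) ^ s) * 2⁻¹ ^ i := by
        intro i
        by_cases hi : x ∈ Ioc (t (i + k₀ + 2)) (y (i + k₀))
        · rw [indicator_of_mem hi]
          have h2 : (2⁻¹ : ℝ≥0∞) = ENNReal.ofReal (1 / 2) := by
            rw [one_div, ENNReal.ofReal_inv_of_pos (by norm_num)]; simp
          rw [h2, ← ENNReal.ofReal_pow (by norm_num), ← ENNReal.ofReal_mul (by positivity)]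
          refine ENNReal.ofReal_le_ofReal ?_
          have hFi : F x ≤ F (t (i + k₀ + 2)) := hanti _ _ hi.1.le
          have hb : 2 * ((1 / 2) ^ (i + k₀) * L) / F (t (i + k₀ + 2)) ≤ 16 / l * (1 / 2) ^ i := by
            rw [div_le_iff₀ (hFpos _)]
            calc 2 * ((1 / 2) ^ (i + k₀) * L) =
                16 / l * (1 / 2) ^ i * (l * ((1 / 2) ^ (k₀ + 2) * L) / 2) := by
                  rw [pow_add, pow_add]; field_simp; norm_num
              _ ≤ _ := by gcongr; exact hFx.trans hFi
          have hb2 : (((1 : ℝ) / 2) ^ i) ^ s ≤ (1 / 2) ^ i := by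
            calc _ ≤ (((1 : ℝ) / 2) ^ i) ^ (1 : ℝ) :=
                  Real.rpow_le_rpow_of_exponent_ge (hpow i) (hpow1 i) hs
              _ = _ := Real.rpow_one _
          calc c (i + k₀) ≤ A * (16 / l * (1 / 2) ^ i) ^ s := by
                simp only [hc]
                have := hFpos (i + k₀ + 2)
                gcongr
            _ = A * (16 / l) ^ s * ((1 / 2) ^ i) ^ s := by
                rw [Real.mul_rpow (by positivity) (by positivity)]; ring
            _ ≤ _ := by gcongr
        · rw [indicator_of_notMem hi]; exact zero_le
      calc _ ≤ ∑' i, ENNReal.ofReal (A * (16 / l) ^ s) * 2⁻¹ ^ i := ENNReal.tsum_le_tsum hterm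
        _ = _ := by
          rw [ENNReal.tsum_mul_left, ENNReal.tsum_geometric, ENNReal.one_sub_inv_two, inv_inv,
            mul_assoc 2, ENNReal.ofReal_mul (zero_le_two (α := ℝ)), ENNReal.ofReal_ofNat, mul_comm]
    · push Not at hex
      simp [indicator_of_notMem (hex _)]
  calc μ (Ioo α β) ≤ μ (⋃ k, Ico (t k) (t (k + 1))) := measure_mono hcover
    _ ≤ ∑' k, μ (Ico (t k) (t (k + 1))) := measure_iUnion_le _
    _ ≤ ∑' k, ENNReal.ofReal (c k) * Φ (Ioc (t (k + 2)) (y k)) := ENNReal.tsum_le_tsum hpiece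
    _ = ∑' k, ∫⁻ x, (Ioc (t (k + 2)) (y k)).indicator (fun _ => ENNReal.ofReal (c k)) x ∂Φ := by
        simp_rw [lintegral_indicator_const measurableSet_Ioc]
    _ = ∫⁻ x, ∑' k, (Ioc (t (k + 2)) (y k)).indicator (fun _ => ENNReal.ofReal (c k)) x ∂Φ :=
        (lintegral_tsum fun k =>
          (measurable_const.indicator measurableSet_Ioc).aemeasurable).symm
    _ ≤ ∫⁻ x, (Ioo α β).indicator (fun _ => ENNReal.ofReal (2 * A * (16 / l) ^ s)) x ∂Φ :=
        lintegral_mono hpt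
    _ = _ := lintegral_indicator_const measurableSet_Ioo _

/-! ### The weak type inequality for the right maximal function -/

theorem locallyIntegrable_abs (hf : LocallyIntegrable f volume) :
    LocallyIntegrable (fun x => |f x|) volume :=
  hf.mono hf.aestronglyMeasurable.norm (ae_of_all _ fun x => by simp)

theorem setLIntegral_Ioc_enorm (hf : LocallyIntegrable f volume) {a b : ℝ} (hab : a ≤ b) :
    ∫⁻ t in Ioc a b, ‖f t‖ₑ = ENNReal.ofReal (∫ t in a..b, |f t|) := by
  rw [← setLIntegral_Ioc_eq_ofReal (locallyIntegrable_abs hf) (fun x => abs_nonneg _) hab]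
  exact lintegral_congr fun t => Real.enorm_eq_ofReal_abs _

theorem ofReal_lt_maximalRight_iff (hf : LocallyIntegrable f volume) {l : ℝ} (hl : 0 < l) (x : ℝ) :
    ENNReal.ofReal l < maximalRight f x ↔ ∃ y, x < y ∧ l * (y - x) < ∫ t in x..y, |f t| := by
  have key : ∀ h, 0 < h → (ENNReal.ofReal l < (∫⁻ t in Ioc x (x + h), ‖f t‖ₑ) / ENNReal.ofReal h ↔
      l * h < ∫ t in x..x + h, |f t|) := by
    intro h hh
    rw [ENNReal.lt_div_iff_mul_lt (Or.inl (by simpa using hh)) (Or.inl ENNReal.ofReal_ne_top),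
      setLIntegral_Ioc_enorm hf (by linarith), ← ENNReal.ofReal_mul hl.le,
      ENNReal.ofReal_lt_ofReal_iff_of_nonneg (by positivity)]
  simp only [maximalRight, lt_iSup_iff, exists_prop]
  constructor
  · rintro ⟨h, hh, hlt⟩
    exact ⟨x + h, by linarith, by simpa using (key h hh).1 hlt⟩
  · rintro ⟨y, hy, hlt⟩
    refine ⟨y - x, sub_pos.2 hy, (key _ (sub_pos.2 hy)).2 ?_⟩
    rwa [add_sub_cancel]

theorem lowerSemicontinuous_maximalRight (hf : LocallyIntegrable f volume) :
    LowerSemicontinuous (maximalRight f) := by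
  refine lowerSemicontinuous_biSup fun h hh => Continuous.lowerSemicontinuous ?_
  have hint := intervalIntegrable_of_locallyIntegrable (locallyIntegrable_abs hf)
  have : (fun x => (∫⁻ t in Ioc x (x + h), ‖f t‖ₑ) / ENNReal.ofReal h) = fun x =>
      ENNReal.ofReal ((∫ t in 0..x + h, |f t|) - ∫ t in 0..x, |f t|) / ENNReal.ofReal h := by
    ext x
    rw [setLIntegral_Ioc_enorm hf (by linarith),
      intervalIntegral.integral_interval_sub_left (hint _ _) (hint _ _)]
  rw [this]
  have hc := intervalIntegral.continuous_primitive hint 0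
  refine ENNReal.continuous_div_const _ (by simpa using hh) |>.comp
    (ENNReal.continuous_ofReal.comp ((hc.comp (continuous_id.add continuous_const)).sub hc))

theorem measurable_maximalRight (hf : LocallyIntegrable f volume) :
    Measurable (maximalRight f) :=
  (lowerSemicontinuous_maximalRight hf).measurable

theorem setOf_lt_maximalRight_eq (hf : LocallyIntegrable f volume) {l : ℝ} (hl : 0 < l) :
    {x | ENNReal.ofReal l < maximalRight f x} =
      ⋃ n : ℕ, shadow (fun x => (∫ t in 0..x, |f t|) - l * x) (-n) n := by
  have hint := intervalIntegrable_of_locallyIntegrable (locallyIntegrable_abs hf)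
  have hadd : ∀ u v, (∫ t in 0..v, |f t|) = (∫ t in 0..u, |f t|) + ∫ t in u..v, |f t| :=
    fun u v => (intervalIntegral.integral_add_adjacent_intervals (hint 0 u) (hint u v)).symm
  ext x
  rw [mem_ofPred_eq, ofReal_lt_maximalRight_iff hf hl, mem_iUnion]
  constructor
  · rintro ⟨y, hxy, hlt⟩
    obtain ⟨n, hn⟩ := exists_nat_gt (max |x| |y|)
    have h1 := abs_lt.1 ((le_max_left _ _).trans_lt hn)
    have h2 := abs_lt.1 ((le_max_right _ _).trans_lt hn)
    refine ⟨n, h1, y, ⟨hxy, h2.2.le⟩, ?_⟩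
    simp only
    rw [hadd x y]; linarith
  · rintro ⟨n, -, y, hy, hlt⟩
    refine ⟨y, hy.1, ?_⟩
    simp only at hlt
    rw [hadd x y] at hlt; linarith

/-- The weak type `(s, s)` inequality for `M⁺` with respect to the weight `σ ^ (1 - p)`, for an
exponent `s` slightly smaller than `p`. -/
theorem IsDualWeight.weak_type (hσ : IsDualWeight p K σ) (hp : 1 < p) (hK : 0 ≤ K)
    {η δ : ℝ} (hη : 0 < η) (hη1 : η ≤ 1) (hηK : η ^ (p - 1) * K ≤ 1 / 2) (hδ : 0 < δ)
    (hδη : 8 * δ ≤ η ^ (1 + δ)) {s : ℝ} (hs : (s - 1) * (1 + δ) = p - 1)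
    (hfm : Measurable f) (hf : LocallyIntegrable f volume) {l : ℝ} (hl : 0 < l) :
    (volume.withDensity fun t => ENNReal.ofReal (σ t ^ (1 - p)))
        {x | ENNReal.ofReal l < maximalRight f x} ≤
      ENNReal.ofReal (2 * (8 ^ p * K) * (16 / l) ^ s) *
        ∫⁻ t, ‖f t‖ₑ ^ s * ENNReal.ofReal (σ t ^ (1 - p)) := by
  have hs1 : 1 < s := by
    by_contra! h
    nlinarith
  have hint := intervalIntegrable_of_locallyIntegrable (locallyIntegrable_abs hf)
  set G : ℝ → ℝ := fun x => (∫ t in 0..x, |f t|) - l * x with hGdef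
  have hG : Continuous G := continuous_integral_sub_mul (locallyIntegrable_abs hf) 0 l
  set μ : Measure ℝ := volume.withDensity fun t => ENNReal.ofReal (σ t ^ (1 - p)) with hμ
  set Φ : Measure ℝ :=
    volume.withDensity fun t => ‖f t‖ₑ ^ s * ENNReal.ofReal (σ t ^ (1 - p)) with hΦ
  set C := ENNReal.ofReal (2 * (8 ^ p * K) * (16 / l) ^ s) with hC
  have hgap : ∀ a b c d : ℝ, a < b → b < c → c < d → d - a ≤ 4 * (c - b) →
      μ (Ico a b) * (∫⁻ t in Ioc c d, ENNReal.ofReal (|f t|)) ^ s ≤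
        ENNReal.ofReal (8 ^ p * K * (d - a) ^ s) * Φ (Ioc c d) := by
    intro a b c d hab hbc hcd h
    have h1 := hσ.gap_bound hp hK hη hη1 hηK hδ hδη hs hab hbc hcd h
    have h2 := rpow_setLIntegral_le hσ.measurable hσ.pos hs1 hs hfm.enorm (Ioc c d)
    simp_rw [← Real.enorm_eq_ofReal_abs]
    rw [hμ, hΦ, withDensity_apply _ measurableSet_Ico, withDensity_apply _ measurableSet_Ioc,
      Measure.restrict_congr_set Ico_ae_eq_Ioc]
    calc _ ≤ (∫⁻ t in Ioc a b, ENNReal.ofReal (σ t ^ (1 - p))) *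
          ((∫⁻ t in Ioc c d, ‖f t‖ₑ ^ s * ENNReal.ofReal (σ t ^ (1 - p))) *
            (∫⁻ t in Ioc c d, ENNReal.ofReal (σ t ^ (1 + δ))) ^ (s - 1)) := by gcongr
      _ = (∫⁻ t in Ioc a b, ENNReal.ofReal (σ t ^ (1 - p))) *
            (∫⁻ t in Ioc c d, ENNReal.ofReal (σ t ^ (1 + δ))) ^ (s - 1) *
          ∫⁻ t in Ioc c d, ‖f t‖ₑ ^ s * ENNReal.ofReal (σ t ^ (1 - p)) := by ring
      _ ≤ _ := by gcongr
  rw [setOf_lt_maximalRight_eq hf hl]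
  have hmono : Monotone fun n : ℕ => shadow G (-n) n := by
    rintro m n hmn x ⟨hx, y, hy, hlt⟩
    have : (m : ℝ) ≤ n := by exact_mod_cast hmn
    exact ⟨⟨by linarith [hx.1], by linarith [hx.2]⟩, y, ⟨hy.1, by linarith [hy.2]⟩, hlt⟩
  rw [hmono.measure_iUnion]
  refine iSup_le fun n => ?_
  have h1 : μ (shadow G (-n) n) ≤ (C • Φ) (shadow G (-n) n) := by
    refine measure_shadow_le hG fun α β _ hαβ _ hmax _ => ?_
    rw [Measure.smul_apply, smul_eq_mul]
    refine measure_Ioo_le_of_gap (locallyIntegrable_abs hf) (fun x => abs_nonneg _)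
      (by positivity) hs1.le hgap hαβ hl fun x hx => ?_
    have h2 := hmax x hx
    have h3 := intervalIntegral.integral_add_adjacent_intervals (hint 0 x) (hint x β)
    simp only [hGdef] at h2
    linarith
  refine h1.trans ?_
  rw [Measure.smul_apply, smul_eq_mul]
  gcongr
  calc _ ≤ Φ univ := measure_mono (subset_univ _)
    _ = _ := by rw [hΦ, withDensity_apply _ MeasurableSet.univ, setLIntegral_univ]

/-! ### The strong type inequality -/

theorem maximalRight_le_add {l : ℝ} (hfm : Measurable f) (x : ℝ) :
    maximalRight f x ≤ maximalRight ({t | l < |f t|}.indicator f) x + ENNReal.ofReal l := by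
  refine iSup₂_le fun h hh => ?_
  have hh' : ENNReal.ofReal h ≠ 0 := by simpa using hh
  have hind : Measurable ({t | l < |f t|}.indicator f) :=
    hfm.indicator (measurableSet_lt measurable_const hfm.abs)
  calc (∫⁻ t in Ioc x (x + h), ‖f t‖ₑ) / ENNReal.ofReal h
      ≤ (∫⁻ t in Ioc x (x + h), (‖{t | l < |f t|}.indicator f t‖ₑ + ENNReal.ofReal l)) /
          ENNReal.ofReal h := by
        gcongr with t
        by_cases ht : t ∈ {t | l < |f t|}
        · rw [indicator_of_mem ht]; exact le_self_add
        · rw [indicator_of_notMem ht, Real.enorm_eq_ofReal_abs]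
          refine le_add_left (ENNReal.ofReal_le_ofReal ?_)
          simpa using ht
    _ = (∫⁻ t in Ioc x (x + h), ‖{t | l < |f t|}.indicator f t‖ₑ) / ENNReal.ofReal h +
          ENNReal.ofReal l := by
        rw [lintegral_add_left hind.enorm, setLIntegral_const, Real.volume_Ioc, add_sub_cancel_left,
          ENNReal.add_div, ENNReal.mul_div_cancel_right hh' ENNReal.ofReal_ne_top]
    _ ≤ _ := by
        gcongr
        exact le_iSup₂ (f := fun h (_ : 0 < h) =>
          (∫⁻ t in Ioc x (x + h), ‖{t | l < |f t|}.indicator f t‖ₑ) / ENNReal.ofReal h) h hh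

theorem rpow_le_lintegral_indicator {p : ℝ} (hp : 0 < p) (c : ℝ≥0∞) :
    c ^ p ≤ ∫⁻ l in Ioi (0 : ℝ),
      {l : ℝ | ENNReal.ofReal l < c}.indicator (fun l => ENNReal.ofReal (p * l ^ (p - 1))) l := by
  have key : ∀ t : ℝ, 0 ≤ t → ENNReal.ofReal t ≤ c → ENNReal.ofReal (t ^ p) ≤
      ∫⁻ l in Ioi (0 : ℝ), {l : ℝ | ENNReal.ofReal l < c}.indicator
        (fun l => ENNReal.ofReal (p * l ^ (p - 1))) l := by
    intro t ht htc
    have h := ofReal_rpow_le_add_lintegral le_rfl ht hp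
    rw [Real.zero_rpow hp.ne', ENNReal.ofReal_zero, zero_add] at h
    refine h.trans ?_
    rw [← lintegral_indicator measurableSet_Ioo, ← lintegral_indicator measurableSet_Ioi]
    refine lintegral_mono fun l => ?_
    by_cases hl : l ∈ Ioo 0 t
    · have h1 : l ∈ Ioi (0 : ℝ) := hl.1
      have h2 : l ∈ {l : ℝ | ENNReal.ofReal l < c} :=
        ((ENNReal.ofReal_lt_ofReal_iff_of_nonneg hl.1.le).2 hl.2).trans_le htc
      simp only [indicator_of_mem hl, indicator_of_mem h1, indicator_of_mem h2, le_refl]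
    · rw [indicator_of_notMem hl]; exact zero_le
  rcases eq_or_ne c ∞ with rfl | hc
  · rw [ENNReal.top_rpow_of_pos hp]
    refine top_le_iff.2 (ENNReal.eq_top_of_forall_nnreal_le fun r => ?_)
    have := key ((r : ℝ) ^ (1 / p)) (by positivity) le_top
    rwa [← Real.rpow_mul r.coe_nonneg, one_div_mul_cancel hp.ne', Real.rpow_one,
      ENNReal.ofReal_coe_nnreal] at this
  · have := key c.toReal ENNReal.toReal_nonneg (ENNReal.ofReal_toReal hc).le
    rwa [← ENNReal.ofReal_rpow_of_nonneg ENNReal.toReal_nonneg hp.le,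
      ENNReal.ofReal_toReal hc] at this

/-- Marcinkiewicz interpolation between the weak type `(s, s)` inequality and the trivial bound
on `L^∞`. -/
theorem IsDualWeight.lintegral_maximalRight_le (hσ : IsDualWeight p K σ) (hp : 1 < p) (hK : 0 ≤ K)
    {η δ : ℝ} (hη : 0 < η) (hη1 : η ≤ 1) (hηK : η ^ (p - 1) * K ≤ 1 / 2) (hδ : 0 < δ)
    (hδη : 8 * δ ≤ η ^ (1 + δ)) {s : ℝ} (hs : (s - 1) * (1 + δ) = p - 1)
    (hfm : Measurable f) (hf : LocallyIntegrable f volume) :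
    ∫⁻ x, maximalRight f x ^ p * ENNReal.ofReal (σ x ^ (1 - p)) ≤
      ENNReal.ofReal (2 * p * 512 ^ p * K / (p - s)) *
        ∫⁻ t, ‖f t‖ₑ ^ p * ENNReal.ofReal (σ t ^ (1 - p)) := by
  have hs1 : 1 < s := by
    by_contra! h
    nlinarith
  have hsp : 0 < p - s := by nlinarith
  have hp0 : 0 < p := by linarith
  have hWm : Measurable fun t => ENNReal.ofReal (σ t ^ (1 - p)) :=
    (hσ.measurable.pow_const _).ennreal_ofReal
  have hMm := measurable_maximalRight hf
  set μ : Measure ℝ := volume.withDensity fun t => ENNReal.ofReal (σ t ^ (1 - p)) with hμ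
  have hΦm : Measurable fun t => ‖f t‖ₑ ^ s * ENNReal.ofReal (σ t ^ (1 - p)) :=
    (hfm.enorm.pow_const _).mul hWm
  set Φ : Measure ℝ :=
    volume.withDensity fun t => ‖f t‖ₑ ^ s * ENNReal.ofReal (σ t ^ (1 - p)) with hΦ
  have hsfin : SFinite μ := by rw [hμ]; infer_instance
  have hsfin' : SFinite Φ := by rw [hΦ]; infer_instance
  set C := 2 * (8 ^ p * K) with hC
  have hC0 : 0 ≤ C := by positivity
  have hφ : Measurable fun l : ℝ => ENNReal.ofReal (p * l ^ (p - 1)) :=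
    ((measurable_id.pow_const _).const_mul _).ennreal_ofReal
  have hφ' : Measurable fun l : ℝ => ENNReal.ofReal ((p - s) * l ^ (p - s - 1)) :=
    ((measurable_id.pow_const _).const_mul _).ennreal_ofReal
  have hE : MeasurableSet {q : ℝ × ℝ | ENNReal.ofReal q.1 < maximalRight f q.2} :=
    measurableSet_lt measurable_fst.ennreal_ofReal (hMm.comp measurable_snd)
  have hE' : MeasurableSet {q : ℝ × ℝ | q.1 / 2 < |f q.2|} :=
    measurableSet_lt (measurable_fst.div_const _) (hfm.comp measurable_snd).abs
  have hlevel : ∀ l ∈ Ioi (0 : ℝ), ENNReal.ofReal (p * l ^ (p - 1)) *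
      μ {x | ENNReal.ofReal l < maximalRight f x} ≤
      ENNReal.ofReal (p * C * 32 ^ s / (p - s)) *
        (ENNReal.ofReal ((p - s) * l ^ (p - s - 1)) * Φ {t | l / 2 < |f t|}) := by
    intro l hl
    have hl : 0 < l := hl
    have hms : MeasurableSet {t | l / 2 < |f t|} := measurableSet_lt measurable_const hfm.abs
    have h1 : μ {x | ENNReal.ofReal l < maximalRight f x} ≤
        ENNReal.ofReal (C * (16 / (l / 2)) ^ s) * Φ {t | l / 2 < |f t|} := by
      have hw := hσ.weak_type hp hK hη hη1 hηK hδ hδη hs (hfm.indicator hms)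
        (hf.indicator hms) (half_pos hl)
      refine le_trans (measure_mono fun x hx => ?_) (hw.trans_eq ?_)
      · have h2 := maximalRight_le_add (l := l / 2) hfm x
        have h3 : ENNReal.ofReal l = ENNReal.ofReal (l / 2) + ENNReal.ofReal (l / 2) := by
          rw [← ENNReal.ofReal_add (by positivity) (by positivity)]; ring_nf
        have h4 : ENNReal.ofReal l < maximalRight f x := hx
        rw [h3] at h4
        exact (ENNReal.add_lt_add_iff_right ENNReal.ofReal_ne_top).1 (h4.trans_le h2)
      · rw [hΦ, withDensity_apply _ hms, ← lintegral_indicator hms]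
        congr 1
        refine lintegral_congr fun t => ?_
        by_cases ht : t ∈ {t | l / 2 < |f t|}
        · simp only [indicator_of_mem ht]
        · simp only [indicator_of_notMem ht, enorm_zero,
            ENNReal.zero_rpow_of_pos (by linarith : 0 < s), zero_mul]
    calc _ ≤ ENNReal.ofReal (p * l ^ (p - 1)) *
          (ENNReal.ofReal (C * (16 / (l / 2)) ^ s) * Φ {t | l / 2 < |f t|}) := by gcongr
      _ = _ := by
        rw [← mul_assoc, ← mul_assoc, ← ENNReal.ofReal_mul (by positivity),
          ← ENNReal.ofReal_mul (by positivity)]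
        congr 2
        rw [show 16 / (l / 2) = 32 / l by field_simp; norm_num,
          Real.div_rpow (by norm_num) hl.le,
          show l ^ (p - s - 1) = l ^ (p - 1) / l ^ s by rw [← Real.rpow_sub hl]; ring_nf]
        generalize l ^ (p - 1) = u
        field_simp
  have hinner : ∀ t, ∫⁻ l in Ioi (0 : ℝ), {q : ℝ × ℝ | q.1 / 2 < |f q.2|}.indicator
      (fun q => ENNReal.ofReal ((p - s) * q.1 ^ (p - s - 1))) (l, t) =
      ENNReal.ofReal ((2 * |f t|) ^ (p - s)) := by
    intro t
    have h1 := lintegral_Ioo_mul_rpow le_rfl (show 0 ≤ 2 * |f t| by positivity) hsp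
    rw [Real.zero_rpow hsp.ne', sub_zero] at h1
    rw [← h1, ← lintegral_indicator measurableSet_Ioo, ← lintegral_indicator measurableSet_Ioi]
    refine lintegral_congr fun l => ?_
    simp only [indicator_apply, mem_Ioi, mem_Ioo, mem_ofPred_eq]
    by_cases h0 : 0 < l
    · have : l / 2 < |f t| ↔ l < 2 * |f t| := by constructor <;> intro h <;> linarith
      simp [h0, this]
    · simp [h0]
  calc ∫⁻ x, maximalRight f x ^ p * ENNReal.ofReal (σ x ^ (1 - p))
      = ∫⁻ x, maximalRight f x ^ p ∂μ := by
        rw [hμ, lintegral_withDensity_eq_lintegral_mul _ hWm (hMm.pow_const _)]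
        exact lintegral_congr fun x => mul_comm _ _
    _ ≤ ∫⁻ x, (∫⁻ l in Ioi (0 : ℝ), {q : ℝ × ℝ | ENNReal.ofReal q.1 < maximalRight f q.2}.indicator
          (fun q => ENNReal.ofReal (p * q.1 ^ (p - 1))) (l, x)) ∂μ :=
        lintegral_mono fun x => rpow_le_lintegral_indicator hp0 _
    _ = ∫⁻ l in Ioi (0 : ℝ), ENNReal.ofReal (p * l ^ (p - 1)) *
          μ {x | ENNReal.ofReal l < maximalRight f x} :=
        (lintegral_mul_measure_section hE _ hφ).symm
    _ ≤ ∫⁻ l in Ioi (0 : ℝ), ENNReal.ofReal (p * C * 32 ^ s / (p - s)) *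
        (ENNReal.ofReal ((p - s) * l ^ (p - s - 1)) * Φ {t | l / 2 < |f t|}) :=
        setLIntegral_mono' measurableSet_Ioi hlevel
    _ = ENNReal.ofReal (p * C * 32 ^ s / (p - s)) *
          ∫⁻ t, ENNReal.ofReal ((2 * |f t|) ^ (p - s)) ∂Φ := by
        rw [lintegral_const_mul' _ _ ENNReal.ofReal_ne_top]
        congr 1
        rw [← lintegral_congr hinner]
        exact lintegral_mul_measure_section hE' _ hφ'
    _ = ENNReal.ofReal (p * C * 32 ^ s / (p - s)) * (ENNReal.ofReal (2 ^ (p - s)) *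
          ∫⁻ t, ‖f t‖ₑ ^ p * ENNReal.ofReal (σ t ^ (1 - p))) := by
        congr 1
        rw [hΦ, lintegral_withDensity_eq_lintegral_mul _ hΦm
          ((hfm.abs.const_mul 2).pow_const _).ennreal_ofReal,
          ← lintegral_const_mul' _ _ ENNReal.ofReal_ne_top]
        refine lintegral_congr fun t => ?_
        rw [Pi.mul_apply, Real.mul_rpow (by norm_num) (abs_nonneg _),
          ENNReal.ofReal_mul (by positivity),
          ← ENNReal.ofReal_rpow_of_nonneg (abs_nonneg _) hsp.le, ← Real.enorm_eq_ofReal_abs,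
          show ‖f t‖ₑ ^ p = ‖f t‖ₑ ^ (p - s) * ‖f t‖ₑ ^ s by
            rw [← ENNReal.rpow_add_of_nonneg _ _ hsp.le (by linarith), sub_add_cancel]]
        ring
    _ ≤ _ := by
        rw [← mul_assoc, ← ENNReal.ofReal_mul (by positivity)]
        gcongr
        have h1 : (32 : ℝ) ^ s ≤ 32 ^ p :=
          Real.rpow_le_rpow_of_exponent_le (by norm_num) (by linarith)
        have h2 : (2 : ℝ) ^ (p - s) ≤ 2 ^ p :=
          Real.rpow_le_rpow_of_exponent_le (by norm_num) (by linarith)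
        have h3 : (8 : ℝ) ^ p * 32 ^ p * 2 ^ p = 512 ^ p := by
          rw [← Real.mul_rpow (by norm_num) (by norm_num),
            ← Real.mul_rpow (by norm_num) (by norm_num)]; norm_num
        calc p * C * 32 ^ s / (p - s) * 2 ^ (p - s) ≤ p * C * 32 ^ p / (p - s) * 2 ^ p := by gcongr
          _ = 2 * p * (8 ^ p * 32 ^ p * 2 ^ p) * K / (p - s) := by rw [hC]; ring
          _ = _ := by rw [h3]

/-- The strong type inequality for `M⁺` with the sharp dependence on `K`: the exponent `s` can be
chosen with `p - s` of the order of `K ^ (-1 / (p - 1))`. -/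
theorem IsDualWeight.strong_type (hσ : IsDualWeight p K σ) (hp : 1 < p) (hK : 1 ≤ K)
    (hfm : Measurable f) (hf : LocallyIntegrable f volume) :
    ∫⁻ x, maximalRight f x ^ p * ENNReal.ofReal (σ x ^ (1 - p)) ≤
      ENNReal.ofReal (96 * p * 512 ^ p * 2 ^ (1 / (p - 1)) / (p - 1) * K ^ (p / (p - 1))) *
        ∫⁻ t, ‖f t‖ₑ ^ p * ENNReal.ofReal (σ t ^ (1 - p)) := by
  have hp1 : 0 < p - 1 := by linarith
  have hK0 : 0 < K := by linarith
  set η : ℝ := (2 * K) ^ (-(1 / (p - 1))) with hη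
  have hη0 : 0 < η := by positivity
  have hη1 : η ≤ 1 :=
    Real.rpow_le_one_of_one_le_of_nonpos (by linarith) (neg_nonpos.2 (by positivity))
  have hηK : η ^ (p - 1) * K ≤ 1 / 2 := by
    rw [hη, ← Real.rpow_mul (by positivity), neg_mul, one_div_mul_cancel hp1.ne', Real.rpow_neg_one]
    field_simp
    norm_num
  -- `η ^ δ ≥ η ^ η` is bounded below, so `δ` may be a fixed multiple of `η`
  set δ := η / 24 with hδ
  have hδ0 : 0 < δ := by positivity
  have hδη : 8 * δ ≤ η ^ (1 + δ) := by
    rw [add_comm, Real.rpow_add_one hη0.ne']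
    have h1 : 1 / 3 ≤ η ^ δ := by
      rw [Real.rpow_def_of_pos hη0]
      have h2 := Real.add_one_le_exp (Real.log η * δ)
      have h3 := Real.one_sub_inv_le_log_of_pos hη0
      have h4 : (1 - η⁻¹) * δ ≤ Real.log η * δ := mul_le_mul_of_nonneg_right h3 hδ0.le
      have h5 : (1 - η⁻¹) * δ = δ - 1 / 24 := by rw [hδ]; field_simp
      linarith
    nlinarith
  set s := 1 + (p - 1) / (1 + δ) with hs
  have hs' : (s - 1) * (1 + δ) = p - 1 := by rw [hs]; field_simp; ring
  have hps : p - s = (p - 1) * δ / (1 + δ) := by rw [hs]; field_simp; ring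
  refine (hσ.lintegral_maximalRight_le hp hK0.le hη0 hη1 hηK hδ0 hδη hs' hfm hf).trans ?_
  gcongr
  have h1 : (p - s)⁻¹ ≤ 48 / (p - 1) * (2 * K) ^ (1 / (p - 1)) := by
    have h2 : (2 * K) ^ (1 / (p - 1)) = η⁻¹ := by
      rw [hη, Real.rpow_neg (by positivity), inv_inv]
    rw [hps, h2, inv_div, div_le_iff₀ (by positivity)]
    have h3 : 48 / (p - 1) * η⁻¹ * ((p - 1) * δ) = 2 := by rw [hδ]; field_simp; norm_num
    rw [h3]
    linarith
  calc 2 * p * 512 ^ p * K / (p - s) = 2 * p * 512 ^ p * K * (p - s)⁻¹ := by ring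
    _ ≤ 2 * p * 512 ^ p * K * (48 / (p - 1) * (2 * K) ^ (1 / (p - 1))) := by gcongr
    _ = 96 * p * 512 ^ p * 2 ^ (1 / (p - 1)) / (p - 1) * (K ^ (1 / (p - 1)) * K) := by
        rw [Real.mul_rpow (by norm_num) hK0.le]; ring
    _ = _ := by
        rw [← Real.rpow_add_one hK0.ne', show 1 / (p - 1) + 1 = p / (p - 1) by field_simp; ring]

/-! ### The upper bound for the operator norm -/

theorem locallyIntegrable_of_lintegral_Ioc (hfm : AEStronglyMeasurable f volume)
    (h : ∀ a b : ℝ, ∫⁻ t in Ioc a b, ‖f t‖ₑ < ∞) : LocallyIntegrable f volume := fun x =>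
  ⟨Ioc (x - 1) (x + 1), Ioc_mem_nhds (by linarith) (by linarith), hfm.restrict, h _ _⟩

/-- Every `A_p^+` weight agrees almost everywhere with `σ ^ (1 - p)` for a normalized dual
weight `σ`. -/
theorem exists_isDualWeight (hp : 1 < p) (hw : ARight p w) :
    ∃ σ, IsDualWeight p (charRight p w).toReal σ ∧ ∀ᵐ x, σ x ^ (1 - p) = w x := by
  obtain ⟨⟨hloc, hpos⟩, hfin⟩ := hw
  have hp1 : 0 < p - 1 := by linarith
  have haem := hloc.aestronglyMeasurable.aemeasurable
  set g := haem.mk w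
  have hgm : Measurable g := haem.measurable_mk
  have hgw : ∀ᵐ x, w x = g x := haem.ae_eq_mk
  set v : ℝ → ℝ := fun x => if 0 < g x then g x else 1 with hv
  have hvm : Measurable v :=
    Measurable.ite (measurableSet_lt measurable_const hgm) hgm measurable_const
  have hv0 : ∀ x, 0 < v x := fun x => by
    simp only [hv]; split_ifs with h
    · exact h
    · exact one_pos
  have hvw : ∀ᵐ x, v x = w x := by
    filter_upwards [hgw, hpos] with x h1 h2
    simp only [hv]; rw [if_pos (h1 ▸ h2), h1]
  set σ : ℝ → ℝ := fun x => v x ^ (1 - p / (p - 1)) with hσ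
  have hσw : ∀ᵐ x, ENNReal.ofReal (σ x) = ENNReal.ofReal (w x ^ (1 - p / (p - 1))) := by
    filter_upwards [hvw] with x hx
    simp only [hσ]; rw [hx]
  have hσv : ∀ x, σ x ^ (1 - p) = v x := fun x => by
    simp only [hσ]
    rw [← Real.rpow_mul (hv0 x).le, show (1 - p / (p - 1)) * (1 - p) = 1 by field_simp; ring,
      Real.rpow_one]
  have hσm : Measurable σ := hvm.pow_const _
  have hσ0 : ∀ x, 0 < σ x := fun x => Real.rpow_pos_of_pos (hv0 x) _
  have hbound : ∀ x h : ℝ, 0 < h →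
      (∫⁻ t in Ioc (x - h) x, ENNReal.ofReal (v t)) *
        (∫⁻ t in Ioc x (x + h), ENNReal.ofReal (σ t)) ^ (p - 1) ≤
        charRight p w * ENNReal.ofReal (h ^ p) := by
    intro x h hh
    have h1 : mean w (x - h) h * (mean (fun t => w t ^ (1 - p / (p - 1))) x h) ^ (p - 1) ≤
        charRight p w := by
      unfold charRight
      exact le_iSup_of_le x (le_iSup₂_of_le h hh le_rfl)
    have e1 : ∫⁻ t in Ioc (x - h) x, ENNReal.ofReal (v t) =
        ∫⁻ t in Ioc (x - h) x, ENNReal.ofReal (w t) :=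
      lintegral_congr_ae (ae_restrict_of_ae (hvw.mono fun t ht => by simp only [ht]))
    have e2 : ∫⁻ t in Ioc x (x + h), ENNReal.ofReal (σ t) =
        ∫⁻ t in Ioc x (x + h), ENNReal.ofReal (w t ^ (1 - p / (p - 1))) :=
      lintegral_congr_ae (ae_restrict_of_ae hσw)
    rw [e1, e2]
    unfold mean at h1
    rw [sub_add_cancel] at h1
    have hh0 : ENNReal.ofReal h ≠ 0 := by simpa using hh
    have hht : ENNReal.ofReal h ≠ ∞ := ENNReal.ofReal_ne_top
    have e3 : ENNReal.ofReal (h ^ p) = ENNReal.ofReal h * ENNReal.ofReal h ^ (p - 1) := by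
      rw [ENNReal.ofReal_rpow_of_pos hh, ← ENNReal.ofReal_mul hh.le]
      congr 1
      rw [mul_comm, ← Real.rpow_add_one hh.ne', sub_add_cancel]
    rw [e3]
    calc _ = (∫⁻ t in Ioc (x - h) x, ENNReal.ofReal (w t)) / ENNReal.ofReal h *
          ((∫⁻ t in Ioc x (x + h), ENNReal.ofReal (w t ^ (1 - p / (p - 1)))) /
            ENNReal.ofReal h) ^ (p - 1) * (ENNReal.ofReal h * ENNReal.ofReal h ^ (p - 1)) := by
          rw [mul_mul_mul_comm, ← ENNReal.mul_rpow_of_nonneg _ _ hp1.le,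
            ENNReal.div_mul_cancel hh0 hht, ENNReal.div_mul_cancel hh0 hht]
      _ ≤ _ := by gcongr
  refine ⟨σ, ⟨hσm, hσ0, ?_, ?_⟩, ?_⟩
  · refine locallyIntegrable_of_lintegral_Ioc hσm.aestronglyMeasurable fun a b => ?_
    rcases le_or_gt b a with hba | hab
    · simp [Ioc_eq_empty (not_lt.2 hba)]
    · have h1 := hbound a (b - a) (sub_pos.2 hab)
      rw [add_sub_cancel] at h1
      have h2 : charRight p w * ENNReal.ofReal ((b - a) ^ p) < ∞ :=
        ENNReal.mul_lt_top hfin ENNReal.ofReal_lt_top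
      have h3 : ∫⁻ t in Ioc (a - (b - a)) a, ENNReal.ofReal (v t) ≠ 0 := by
        rw [← zero_lt_iff, setLIntegral_pos_iff hvm.ennreal_ofReal]
        have : Function.support (fun t => ENNReal.ofReal (v t)) = univ := by
          ext t; simp [hv0 t]
        rw [this, univ_inter, Real.volume_Ioc]
        simpa using hab
      have h4 := ENNReal.lt_top_of_mul_ne_top_right (h1.trans_lt h2).ne h3
      have h5 := (ENNReal.rpow_lt_top_iff_of_pos hp1).1 h4
      refine lt_of_le_of_lt (lintegral_mono fun t => ?_) h5
      rw [Real.enorm_eq_ofReal_abs, abs_of_pos (hσ0 t)]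
  · intro x h hh
    simp_rw [hσv]
    rw [ENNReal.ofReal_mul ENNReal.toReal_nonneg, ENNReal.ofReal_toReal hfin.ne]
    exact hbound x h hh
  · simpa only [hσv] using hvw

/-- The characteristic is at least `1`, by Lebesgue's differentiation theorem. -/
theorem IsDualWeight.one_le (hσ : IsDualWeight p K σ) (hp : 1 < p)
    (hw : LocallyIntegrable (fun x => σ x ^ (1 - p)) volume) : 1 ≤ K := by
  have hp1 : 0 < p - 1 := by linarith
  obtain ⟨x, h1, h2⟩ := ((LocallyIntegrable.ae_hasDerivAt_integral hw).and
    (LocallyIntegrable.ae_hasDerivAt_integral hσ.locallyIntegrable)).exists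
  have hint := intervalIntegrable_of_locallyIntegrable hσ.locallyIntegrable
  have hintw := intervalIntegrable_of_locallyIntegrable hw
  have hr := (h2 x).tendsto_slope_zero_right
  have hl := ((h1 x).tendsto_slope_zero_left).comp
    (show Filter.Tendsto (fun h : ℝ => -h) (nhdsWithin 0 (Ioi 0)) (nhdsWithin 0 (Iio 0)) by
      simpa using tendsto_neg_nhdsGT (a := (0 : ℝ)))
  have hlim := hl.mul (hr.rpow_const (p := p - 1) (Or.inr hp1.le))
  have hone : σ x ^ (1 - p) * σ x ^ (p - 1) = 1 := by
    rw [← Real.rpow_add (hσ.pos x)]; simp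
  rw [hone] at hlim
  refine le_of_tendsto hlim ?_
  filter_upwards [self_mem_nhdsWithin] with h hh
  have hh : 0 < h := hh
  have hb := hσ.bound x h hh
  have hw0 : ∀ t, 0 ≤ σ t ^ (1 - p) := fun t => Real.rpow_nonneg (hσ.pos t).le _
  have hB0 : 0 ≤ ∫ t in x..x + h, σ t :=
    intervalIntegral.integral_nonneg (by linarith) fun t _ => (hσ.pos t).le
  have hA0 : 0 ≤ ∫ t in x - h..x, σ t ^ (1 - p) :=
    intervalIntegral.integral_nonneg (by linarith) fun t _ => hw0 t
  rw [setLIntegral_Ioc_eq_ofReal hw hw0 (by linarith),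
    setLIntegral_Ioc_eq_ofReal hσ.locallyIntegrable (fun t => (hσ.pos t).le) (by linarith),
    ENNReal.ofReal_rpow_of_nonneg hB0 hp1.le, ← ENNReal.ofReal_mul hA0] at hb
  have hpos : 0 < (∫ t in x - h..x, σ t ^ (1 - p)) * (∫ t in x..x + h, σ t) ^ (p - 1) :=
    mul_pos (intervalIntegral.intervalIntegral_pos_of_pos (hintw _ _)
      (fun t => Real.rpow_pos_of_pos (hσ.pos t) _) (by linarith)) (Real.rpow_pos_of_pos
        (intervalIntegral.intervalIntegral_pos_of_pos (hint _ _) hσ.pos (by linarith)) _)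
  have hb' := ((ENNReal.ofReal_le_ofReal_iff' ).1 hb).resolve_right (not_le.2 hpos)
  have e1 : ∫ t in x..x - h, σ t ^ (1 - p) = -∫ t in x - h..x, σ t ^ (1 - p) :=
    intervalIntegral.integral_symm _ _
  simp only [Function.comp_apply, smul_eq_mul, intervalIntegral.integral_same, sub_zero,
    ← sub_eq_add_neg, e1]
  rw [show (-h)⁻¹ * -∫ t in x - h..x, σ t ^ (1 - p) = h⁻¹ * ∫ t in x - h..x, σ t ^ (1 - p) by
    rw [inv_neg, neg_mul_neg], Real.mul_rpow (by positivity) hB0, Real.inv_rpow hh.le]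
  have e2 : h ^ p = h * h ^ (p - 1) := by
    rw [mul_comm, ← Real.rpow_add_one hh.ne', sub_add_cancel]
  have hq : 0 < h ^ (p - 1) := by positivity
  rw [e2] at hb'
  calc _ = ((∫ t in x - h..x, σ t ^ (1 - p)) * (∫ t in x..x + h, σ t) ^ (p - 1)) /
        (h * h ^ (p - 1)) := by field_simp
    _ ≤ K := by rw [div_le_iff₀ (by positivity)]; exact hb'

theorem one_le_charRight (hp : 1 < p) (hw : ARight p w) : 1 ≤ (charRight p w).toReal := by
  obtain ⟨σ, hσ, hσw⟩ := exists_isDualWeight hp hw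
  exact hσ.one_le hp (hw.1.locallyIntegrable.congr (hσw.mono fun x hx => hx.symm))

theorem eLpNorm_ofReal_eq {E : Type*} [ENorm E] (hp : 0 < p) (μ : Measure ℝ) (g : ℝ → E) :
    eLpNorm g (ENNReal.ofReal p) μ = (∫⁻ x, ‖g x‖ₑ ^ p ∂μ) ^ (1 / p) := by
  rw [eLpNorm_eq_lintegral_rpow_enorm_toReal (by simpa using hp) ENNReal.ofReal_ne_top,
    ENNReal.toReal_ofReal hp.le]

theorem maximalRight_congr {f g : ℝ → ℝ} (hfg : f =ᵐ[volume] g) :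
    maximalRight f = maximalRight g := by
  ext x
  unfold maximalRight
  congr! 4 with h hh
  exact lintegral_congr_ae (ae_restrict_of_ae (hfg.mono fun t ht => by simp only [ht]))

theorem opNorm_maximalRight_le (hp : 1 < p) :
    ∃ c : ℝ≥0, ∀ w : ℝ → ℝ, ARight p w →
      opNorm p w maximalRight ≤ c * charRight p w ^ (1 / (p - 1)) := by
  have hp0 : 0 < p := by linarith
  have hp1 : 0 < p - 1 := by linarith
  set C := 96 * p * 512 ^ p * 2 ^ (1 / (p - 1)) / (p - 1) with hC
  have hC0 : 0 < C := by positivity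
  refine ⟨(C ^ (1 / p)).toNNReal, fun w hw => ?_⟩
  obtain ⟨σ, hσ, hσw⟩ := exists_isDualWeight hp hw
  have hK := one_le_charRight hp hw
  set K := (charRight p w).toReal with hKdef
  have hKc : charRight p w = ENNReal.ofReal K := (ENNReal.ofReal_toReal hw.2.ne).symm
  have hWm : Measurable fun t => ENNReal.ofReal (σ t ^ (1 - p)) :=
    (hσ.measurable.pow_const _).ennreal_ofReal
  have hμ : weightMeasure w = volume.withDensity fun t => ENNReal.ofReal (σ t ^ (1 - p)) :=
    withDensity_congr_ae (hσw.mono fun t ht => by simp only [ht])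
  have hac : volume ≪ weightMeasure w := by
    rw [hμ]
    refine withDensity_absolutelyContinuous' hWm.aemeasurable (ae_of_all _ fun t => ?_)
    simpa using Real.rpow_pos_of_pos (hσ.pos t) _
  have hint : ∀ g : ℝ → ℝ≥0∞, Measurable g → ∫⁻ x, g x ^ p ∂(weightMeasure w) =
      ∫⁻ x, g x ^ p * ENNReal.ofReal (σ x ^ (1 - p)) := by
    intro g hg
    rw [hμ, lintegral_withDensity_eq_lintegral_mul _ hWm (hg.pow_const _)]
    exact lintegral_congr fun x => mul_comm _ _
  refine iSup_le fun f => iSup₂_le fun hf hf1 => ?_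
  have hfa := hf.1.aemeasurable
  set f₀ := hfa.mk f
  have hf₀m : Measurable f₀ := hfa.measurable_mk
  rw [eLpNorm_congr_ae hfa.ae_eq_mk, eLpNorm_ofReal_eq hp0, hint _ hf₀m.enorm] at hf1
  have hI1 : ∫⁻ x, ‖f₀ x‖ₑ ^ p * ENNReal.ofReal (σ x ^ (1 - p)) ≤ 1 := by
    have := ENNReal.rpow_le_rpow hf1 hp0.le
    rwa [← ENNReal.rpow_mul, one_div_mul_cancel hp0.ne', ENNReal.rpow_one,
      ENNReal.one_rpow] at this
  have hf₀ : LocallyIntegrable f₀ volume := by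
    refine locallyIntegrable_of_lintegral_Ioc hf₀m.aestronglyMeasurable fun a b => ?_
    have h1 := rpow_setLIntegral_le (p := p) (δ := 0) hσ.measurable hσ.pos hp (by ring)
      hf₀m.enorm (Ioc a b)
    refine (ENNReal.rpow_lt_top_iff_of_pos hp0).1 (h1.trans_lt (ENNReal.mul_lt_top ?_ ?_))
    · exact (setLIntegral_le_lintegral _ _).trans_lt (hI1.trans_lt ENNReal.one_lt_top)
    · refine ENNReal.rpow_lt_top_of_nonneg hp1.le ?_
      simp only [add_zero, Real.rpow_one]
      rw [← Measure.restrict_congr_set Ioo_ae_eq_Ioc]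
      exact (hσ.lintegral_Ioo_lt_top a b).ne
  rw [maximalRight_congr (hac.ae_le hfa.ae_eq_mk), eLpNorm_ofReal_eq hp0]
  simp only [enorm_eq_self]
  rw [hint _ (measurable_maximalRight hf₀)]
  have hst := hσ.strong_type hp hK hf₀m hf₀
  calc _ ≤ (ENNReal.ofReal (C * K ^ (p / (p - 1)))) ^ (1 / p) := by
        gcongr
        refine hst.trans ?_
        calc _ ≤ ENNReal.ofReal (C * K ^ (p / (p - 1))) * 1 := by gcongr
          _ = _ := mul_one _
    _ = _ := by
        have hK0 : 0 < K := by linarith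
        rw [hKc, ENNReal.ofReal_rpow_of_pos (by positivity), ENNReal.ofReal_rpow_of_pos hK0,
          Real.mul_rpow hC0.le (by positivity), ← Real.rpow_mul hK0.le,
          ENNReal.ofReal_mul (by positivity),
          show p / (p - 1) * (1 / p) = 1 / (p - 1) by field_simp]
        rfl

/-! ### Power weights -/

/-- The power weight `|x| ^ ((p - 1) (1 - δ))`, whose characteristic is of the order of
`δ ^ (1 - p)` as `δ → 0`. -/
noncomputable def powerWeight (p δ : ℝ) (x : ℝ) : ℝ := |x| ^ ((p - 1) * (1 - δ))

theorem powerWeight_dual (hp : 1 < p) (δ x : ℝ) :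
    powerWeight p δ x ^ (1 - p / (p - 1)) = |x| ^ (δ - 1) := by
  have hp1 : p - 1 ≠ 0 := by linarith
  rw [powerWeight, ← Real.rpow_mul (abs_nonneg x)]
  congr 1
  field_simp
  ring

theorem isWeight_powerWeight (hp : 1 < p) {δ : ℝ} (hδ1 : δ ≤ 1) : IsWeight (powerWeight p δ) := by
  have ha : 0 ≤ (p - 1) * (1 - δ) := mul_nonneg (by linarith) (by linarith)
  refine ⟨(continuous_abs.rpow_const fun _ => Or.inr ha).locallyIntegrable, ?_⟩
  have : ∀ᵐ x : ℝ, x ≠ 0 := by simp [ae_iff, measure_singleton]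
  filter_upwards [this] with x hx
  exact Real.rpow_pos_of_pos (abs_pos.2 hx) _

theorem setLIntegral_Ioo_abs_rpow_right {δ R : ℝ} (hδ : 0 < δ) (hR : 0 ≤ R) :
    ∫⁻ t in Ioo 0 R, ENNReal.ofReal (δ * |t| ^ (δ - 1)) = ENNReal.ofReal (R ^ δ) := by
  have h := lintegral_Ioo_mul_rpow le_rfl hR hδ
  rw [Real.zero_rpow hδ.ne', sub_zero] at h
  rw [← h]
  exact setLIntegral_congr_fun measurableSet_Ioo fun t ht => by simp only [abs_of_pos ht.1]

theorem setLIntegral_Ioo_abs_rpow_left {δ R : ℝ} (hδ : 0 < δ) (hR : 0 ≤ R) :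
    ∫⁻ t in Ioo (-R) 0, ENNReal.ofReal (δ * |t| ^ (δ - 1)) = ENNReal.ofReal (R ^ δ) := by
  rw [← setLIntegral_Ioo_abs_rpow_right hδ hR]
  have h := (Measure.measurePreserving_neg (volume : Measure ℝ)).setLIntegral_comp_preimage_emb
    (MeasurableEquiv.neg ℝ).measurableEmbedding
    (fun t => ENNReal.ofReal (δ * |t| ^ (δ - 1))) (Ioo (-R) 0)
  rw [← h]
  simp

theorem mean_le_of_le {g : ℝ → ℝ} {a h B : ℝ}
    (hB : ∀ t ∈ Ioc a (a + h), g t ≤ B) : mean g a h ≤ ENNReal.ofReal B := by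
  unfold mean
  refine ENNReal.div_le_of_le_mul ?_
  calc _ ≤ ∫⁻ t in Ioc a (a + h), ENNReal.ofReal B :=
        setLIntegral_mono' measurableSet_Ioc fun t ht => ENNReal.ofReal_le_ofReal (hB t ht)
    _ = _ := by rw [setLIntegral_const, Real.volume_Ioc, add_sub_cancel_left]

theorem mean_abs_rpow_le {δ x h : ℝ} (hδ : 0 < δ) (hh : 0 < h) (hx : |x| ≤ 2 * h) :
    mean (fun t => |t| ^ (δ - 1)) x h ≤ ENNReal.ofReal (6 / δ * (3 * h) ^ (δ - 1)) := by
  obtain ⟨hx1, hx2⟩ := abs_le.1 hx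
  have h3 : 0 < 3 * h := by linarith
  unfold mean
  refine ENNReal.div_le_of_le_mul ?_
  have hsub : Ioc x (x + h) ⊆ Icc (-(3 * h)) (3 * h) := fun t ht =>
    ⟨by linarith [ht.1], by linarith [ht.2]⟩
  have hsplit : Icc (-(3 * h)) (3 * h) ⊆ Icc (-(3 * h)) 0 ∪ Icc 0 (3 * h) := fun t ht => by
    rcases le_total t 0 with h | h
    · exact Or.inl ⟨ht.1, h⟩
    · exact Or.inr ⟨h, ht.2⟩
  have hscale : ∀ S : Set ℝ, ∫⁻ t in S, ENNReal.ofReal (|t| ^ (δ - 1)) =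
      ENNReal.ofReal (1 / δ) * ∫⁻ t in S, ENNReal.ofReal (δ * |t| ^ (δ - 1)) := fun S => by
    rw [← lintegral_const_mul' _ _ ENNReal.ofReal_ne_top]
    refine lintegral_congr fun t => ?_
    rw [← ENNReal.ofReal_mul (by positivity)]
    congr 1
    field_simp
  calc _ ≤ ∫⁻ t in Icc (-(3 * h)) 0 ∪ Icc 0 (3 * h), ENNReal.ofReal (|t| ^ (δ - 1)) :=
        lintegral_mono_set (hsub.trans hsplit)
    _ ≤ (∫⁻ t in Icc (-(3 * h)) 0, ENNReal.ofReal (|t| ^ (δ - 1))) +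
          ∫⁻ t in Icc 0 (3 * h), ENNReal.ofReal (|t| ^ (δ - 1)) := lintegral_union_le _ _ _
    _ = ENNReal.ofReal (1 / δ) * ENNReal.ofReal ((3 * h) ^ δ) +
          ENNReal.ofReal (1 / δ) * ENNReal.ofReal ((3 * h) ^ δ) := by
        rw [hscale, hscale, ← Measure.restrict_congr_set Ioo_ae_eq_Icc,
          ← Measure.restrict_congr_set Ioo_ae_eq_Icc, setLIntegral_Ioo_abs_rpow_left hδ h3.le,
          setLIntegral_Ioo_abs_rpow_right hδ h3.le]
    _ = _ := by
        rw [← ENNReal.ofReal_mul (by positivity), ← ENNReal.ofReal_add (by positivity)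
          (by positivity), ← ENNReal.ofReal_mul (by positivity),
          show (3 * h) ^ δ = (3 * h) ^ (δ - 1) * (3 * h) by
            rw [← Real.rpow_add_one h3.ne', sub_add_cancel]]
        ring_nf

theorem charRight_powerWeight_le (hp : 1 < p) {δ : ℝ} (hδ : 0 < δ) (hδ1 : δ ≤ 1) :
    charRight p (powerWeight p δ) ≤ ENNReal.ofReal ((6 / δ) ^ (p - 1)) := by
  have hp1 : 0 < p - 1 := by linarith
  have hδ' : 0 ≤ 1 - δ := by linarith
  have ha : 0 ≤ (p - 1) * (1 - δ) := mul_nonneg hp1.le hδ'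
  refine iSup_le fun x => iSup₂_le fun h hh => ?_
  simp_rw [powerWeight_dual hp]
  -- it suffices to bound the weight by `A` and the mean of its dual by `B`
  have key : ∀ A B : ℝ, 0 < A → 0 < B →
      (∀ t ∈ Ioc (x - h) x, powerWeight p δ t ≤ A ^ ((p - 1) * (1 - δ))) →
      mean (fun t => |t| ^ (δ - 1)) x h ≤ ENNReal.ofReal B →
      B * A ^ (1 - δ) ≤ 6 / δ →
      mean (powerWeight p δ) (x - h) h * mean (fun t => |t| ^ (δ - 1)) x h ^ (p - 1) ≤
        ENNReal.ofReal ((6 / δ) ^ (p - 1)) := by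
    intro A B hA hB h1 h2 h3
    have h4 : mean (powerWeight p δ) (x - h) h ≤ ENNReal.ofReal (A ^ ((p - 1) * (1 - δ))) :=
      mean_le_of_le fun t ht => h1 t (by rwa [sub_add_cancel] at ht)
    calc _ ≤ ENNReal.ofReal (A ^ ((p - 1) * (1 - δ))) * ENNReal.ofReal B ^ (p - 1) := by gcongr
      _ = ENNReal.ofReal ((B * A ^ (1 - δ)) ^ (p - 1)) := by
          rw [ENNReal.ofReal_rpow_of_pos hB, ← ENNReal.ofReal_mul (by positivity),
            Real.mul_rpow hB.le (by positivity), ← Real.rpow_mul hA.le, mul_comm (1 - δ), mul_comm]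
      _ ≤ _ := by gcongr
  rcases le_or_gt |x| (2 * h) with hx | hx
  · have h3 : 0 < 3 * h := by linarith
    obtain ⟨hx1, hx2⟩ := abs_le.1 hx
    refine key (3 * h) (6 / δ * (3 * h) ^ (δ - 1)) h3 (by positivity) (fun t ht => ?_)
      (mean_abs_rpow_le hδ hh hx) ?_
    · exact Real.rpow_le_rpow (abs_nonneg t)
        (abs_le.2 ⟨by linarith [ht.1], by linarith [ht.2]⟩) ha
    · rw [mul_assoc, ← Real.rpow_add h3]
      simp
  · have hx0 : 0 < |x| := by linarith
    refine key (3 / 2 * |x|) ((|x| / 2) ^ (δ - 1)) (by positivity) (by positivity)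
      (fun t ht => ?_) (mean_le_of_le fun t ht => ?_) ?_
    · refine Real.rpow_le_rpow (abs_nonneg t) ?_ ha
      have h1 : |t| ≤ |x| + |t - x| := by
        have := abs_add_le x (t - x); rwa [add_sub_cancel] at this
      have h2 : |t - x| ≤ h := abs_le.2 ⟨by linarith [ht.1], by linarith [ht.2]⟩
      linarith
    · refine Real.rpow_le_rpow_of_nonpos (by positivity) ?_ (by linarith)
      have h1 : |x| ≤ |t| + |x - t| := by
        have := abs_add_le t (x - t); rwa [add_sub_cancel] at this
      have h2 : |x - t| ≤ h := abs_le.2 ⟨by linarith [ht.2], by linarith [ht.1]⟩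
      linarith
    · have e1 : (3 / 2 * |x|) ^ (1 - δ) = 3 ^ (1 - δ) * (|x| / 2) ^ (1 - δ) := by
        rw [← Real.mul_rpow (by norm_num) (by positivity)]; ring_nf
      have e2 : (|x| / 2) ^ (δ - 1) * (|x| / 2) ^ (1 - δ) = 1 := by
        rw [← Real.rpow_add (by positivity)]; simp
      have e3 : (3 : ℝ) ^ (1 - δ) ≤ 3 ^ (1 : ℝ) :=
        Real.rpow_le_rpow_of_exponent_le (by norm_num) (by linarith)
      rw [Real.rpow_one] at e3
      have e4 : 6 ≤ 6 / δ := by rw [le_div_iff₀ hδ]; linarith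
      calc _ = 3 ^ (1 - δ) * ((|x| / 2) ^ (δ - 1) * (|x| / 2) ^ (1 - δ)) := by rw [e1]; ring
        _ ≤ 6 / δ := by rw [e2]; linarith

theorem le_opNorm_powerWeight (hp : 1 < p) {δ : ℝ} (hδ : 0 < δ) :
    ENNReal.ofReal (1 / δ) ≤ opNorm p (powerWeight p δ) maximalRight := by
  have hp0 : 0 < p := by linarith
  -- `M⁺ f ≥ f / δ`, by taking the mean over `(x, 0)`; the factor `δ ^ (1 / p)` normalizes `f`
  set f : ℝ → ℝ := (Ioo (-1) 0).indicator fun x => δ ^ (1 / p) * |x| ^ (δ - 1) with hf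
  have hfm : Measurable f :=
    ((measurable_id.abs.pow_const _).const_mul _).indicator measurableSet_Ioo
  have hwm : Measurable fun x => ENNReal.ofReal (powerWeight p δ x) :=
    (measurable_id.abs.pow_const _).ennreal_ofReal
  have hint : ∀ g : ℝ → ℝ≥0∞, Measurable g → ∫⁻ x, g x ^ p ∂(weightMeasure (powerWeight p δ)) =
      ∫⁻ x, ENNReal.ofReal (powerWeight p δ x) * g x ^ p := by
    intro g hg
    rw [weightMeasure, lintegral_withDensity_eq_lintegral_mul _ hwm (hg.pow_const _)]
    rfl
  have hnorm : eLpNorm f (ENNReal.ofReal p) (weightMeasure (powerWeight p δ)) = 1 := by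
    rw [eLpNorm_ofReal_eq hp0, hint _ hfm.enorm]
    have h1 : ∀ x, ENNReal.ofReal (powerWeight p δ x) * ‖f x‖ₑ ^ p =
        (Ioo (-1) 0).indicator (fun t => ENNReal.ofReal (δ * |t| ^ (δ - 1))) x := by
      intro x
      by_cases hx : x ∈ Ioo (-1 : ℝ) 0
      · have hx0 : 0 < |x| := abs_pos.2 hx.2.ne
        simp only [hf, indicator_of_mem hx]
        rw [Real.enorm_eq_ofReal_abs, abs_of_pos (by positivity),
          ENNReal.ofReal_rpow_of_pos (by positivity), powerWeight,
          ← ENNReal.ofReal_mul (by positivity), Real.mul_rpow (by positivity) (by positivity),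
          ← Real.rpow_mul hδ.le, ← Real.rpow_mul hx0.le, one_div_mul_cancel hp0.ne', Real.rpow_one,
          mul_left_comm, ← Real.rpow_add hx0]
        congr 3
        ring
      · simp only [hf, indicator_of_notMem hx, enorm_zero, ENNReal.zero_rpow_of_pos hp0, mul_zero]
    rw [lintegral_congr h1, lintegral_indicator measurableSet_Ioo,
      setLIntegral_Ioo_abs_rpow_left hδ zero_le_one]
    simp
  have hM : ∀ x, ENNReal.ofReal (1 / δ) * ‖f x‖ₑ ≤ maximalRight f x := by
    intro x
    by_cases hx : x ∈ Ioo (-1 : ℝ) 0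
    · have hx0 : 0 < -x := by linarith [hx.2]
      have habs : |x| = -x := abs_of_neg hx.2
      refine le_trans ?_ (le_iSup₂ (f := fun h (_ : 0 < h) =>
        (∫⁻ t in Ioc x (x + h), ‖f t‖ₑ) / ENNReal.ofReal h) (-x) hx0)
      have h1 : ∫⁻ t in Ioc x (x + -x), ‖f t‖ₑ =
          ENNReal.ofReal (δ ^ (1 / p) / δ) * ENNReal.ofReal ((-x) ^ δ) := by
        rw [add_neg_cancel, ← Measure.restrict_congr_set Ioo_ae_eq_Ioc,
          ← setLIntegral_Ioo_abs_rpow_left hδ hx0.le, neg_neg,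
          ← lintegral_const_mul' _ _ ENNReal.ofReal_ne_top]
        refine setLIntegral_congr_fun measurableSet_Ioo fun t ht => ?_
        have htm : t ∈ Ioo (-1 : ℝ) 0 := ⟨hx.1.trans ht.1, ht.2⟩
        have ht0 : 0 < |t| := abs_pos.2 ht.2.ne
        simp only [hf, indicator_of_mem htm]
        rw [Real.enorm_eq_ofReal_abs, abs_of_pos (by positivity), ← ENNReal.ofReal_mul
          (by positivity)]
        congr 1
        field_simp
      rw [h1]
      simp only [hf, indicator_of_mem hx]
      rw [Real.enorm_eq_ofReal_abs, habs, abs_of_pos (by positivity),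
        ← ENNReal.ofReal_mul (by positivity), ← ENNReal.ofReal_mul (by positivity),
        ← ENNReal.ofReal_div_of_pos hx0]
      refine ENNReal.ofReal_le_ofReal (le_of_eq ?_)
      rw [show (-x) ^ δ = (-x) ^ (δ - 1) * -x by rw [← Real.rpow_add_one hx0.ne', sub_add_cancel]]
      have hx1 : x ≠ 0 := hx.2.ne
      field_simp
    · simp [hf, indicator_of_notMem hx]
  have hmem : MemLp f (ENNReal.ofReal p) (weightMeasure (powerWeight p δ)) :=
    ⟨hfm.aestronglyMeasurable, by rw [hnorm]; exact ENNReal.one_lt_top⟩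
  refine le_trans ?_ (le_iSup_of_le f (le_iSup₂_of_le hmem hnorm.le le_rfl))
  have hnorm' := hnorm
  rw [eLpNorm_ofReal_eq hp0] at hnorm' ⊢
  simp only [enorm_eq_self]
  calc ENNReal.ofReal (1 / δ) = (ENNReal.ofReal (1 / δ) ^ p *
        ∫⁻ x, ‖f x‖ₑ ^ p ∂(weightMeasure (powerWeight p δ))) ^ (1 / p) := by
        rw [ENNReal.mul_rpow_of_nonneg _ _ (by positivity), hnorm', mul_one, ← ENNReal.rpow_mul,
          mul_one_div_cancel hp0.ne', ENNReal.rpow_one]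
    _ ≤ _ := by
        rw [← lintegral_const_mul _ (hfm.enorm.pow_const _)]
        gcongr with x
        rw [← ENNReal.mul_rpow_of_nonneg _ _ hp0.le]
        exact ENNReal.rpow_le_rpow (hM x) hp0.le

/-! ### Sharpness of the exponent -/

/-- The exponent `β` is best possible if the bound `N ≤ c K ^ β` holds and is attained, up to a
constant factor, along weights with `N` unbounded. -/
theorem bestPossible_of_attained {A : (ℝ → ℝ) → Prop} {N K : (ℝ → ℝ) → ℝ≥0∞} {β : ℝ} (hβ : 0 < β)
    (hK : ∀ w, A w → 1 ≤ (K w).toReal) {c : ℝ≥0} (hupper : ∀ w, A w → N w ≤ c * K w ^ β)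
    {b : ℝ} (hlower : ∀ n : ℕ, 1 ≤ n →
      ∃ w, A w ∧ K w ^ β ≤ ENNReal.ofReal (b * n) ∧ ENNReal.ofReal n ≤ N w) :
    BestPossible A N K β := by
  have hlarge : ∀ T : ℝ, 0 ≤ T → ∃ (n : ℕ) (w : ℝ → ℝ) (k : ℝ), 1 ≤ n ∧ A w ∧ 1 ≤ k ∧ T ≤ k ∧
      K w = ENNReal.ofReal k ∧ k ^ β ≤ b * n ∧ ENNReal.ofReal n ≤ N w := by
    intro T hT
    obtain ⟨n, hn⟩ := exists_nat_gt (max (c * T ^ β) 1)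
    have hn1 : (1 : ℝ) < n := (le_max_right _ _).trans_lt hn
    have hnT : c * T ^ β < n := (le_max_left _ _).trans_lt hn
    obtain ⟨w, hw, hwK, hwN⟩ := hlower n (by exact_mod_cast hn1.le)
    have hk := hK w hw
    set k := (K w).toReal
    have hfin : K w ≠ ∞ := fun h => by
      have : k = 0 := by simp [k, h]
      linarith
    have hKk : K w = ENNReal.ofReal k := (ENNReal.ofReal_toReal hfin).symm
    have hk0 : 0 < k := by linarith
    have hup := hwN.trans (hupper w hw)
    rw [hKk, ENNReal.ofReal_rpow_of_pos hk0] at hwK hup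
    rw [show (c : ℝ≥0∞) = ENNReal.ofReal c by simp, ← ENNReal.ofReal_mul c.coe_nonneg,
      ENNReal.ofReal_le_ofReal_iff (by positivity)] at hup
    have hbn := ((ENNReal.ofReal_le_ofReal_iff').1 hwK).resolve_right
      (not_le.2 (by positivity))
    refine ⟨n, w, k, by exact_mod_cast hn1.le, hw, hk, ?_, hKk, hbn, hwN⟩
    by_contra! hlt
    have h1 : k ^ β ≤ T ^ β := Real.rpow_le_rpow hk0.le hlt.le hβ.le
    have h2 : c * k ^ β ≤ c * T ^ β := mul_le_mul_of_nonneg_left h1 c.coe_nonneg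
    linarith
  have hb : 0 < b := by
    obtain ⟨n, w, k, hn, -, hk, -, -, h, -⟩ := hlarge 0 le_rfl
    have hn' : (0 : ℝ) < n := by exact_mod_cast hn
    have : 0 < k ^ β := by positivity
    exact pos_of_mul_pos_left (this.trans_le h) hn'.le
  refine ⟨?_, ?_⟩
  · rintro ψ ⟨-, -, hψ⟩ ⟨C, hC⟩
    have hε : 0 < 1 / (2 * b * (C + 1)) := by positivity
    obtain ⟨T, hT⟩ := Filter.eventually_atTop.1 (hψ.bound hε)
    obtain ⟨n, w, k, hn, hw, hk, hTk, hKk, hkn, hN⟩ := hlarge (max T 0) (le_max_right _ _)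
    have h1 := hT k ((le_max_left _ _).trans hTk)
    have hk0 : 0 < k := by linarith
    have hn' : (0 : ℝ) < n := by exact_mod_cast hn
    rw [Real.norm_eq_abs, Real.norm_eq_abs, abs_of_pos (by positivity : 0 < k ^ β)] at h1
    have h2 := hN.trans (hC w hw)
    rw [hKk, ENNReal.toReal_ofReal hk0.le, show (C : ℝ≥0∞) = ENNReal.ofReal C by simp,
      ← ENNReal.ofReal_mul C.coe_nonneg] at h2
    have h3 := ((ENNReal.ofReal_le_ofReal_iff').1 h2).resolve_right (not_le.2 hn')
    have h4 : C * ψ k ≤ C * (1 / (2 * b * (C + 1)) * (b * n)) := by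
      refine mul_le_mul_of_nonneg_left ((le_abs_self _).trans (h1.trans ?_)) C.coe_nonneg
      gcongr
    have h5 : C * (1 / (2 * b * (C + 1)) * (b * n)) = C / (C + 1) * (n / 2 : ℝ) := by
      field_simp
    have h6 : (C : ℝ) / (C + 1) ≤ 1 := by
      rw [div_le_one (by positivity)]; linarith
    nlinarith
  · intro ε hε
    refine ENNReal.eq_top_of_forall_nnreal_le fun B => ?_
    obtain ⟨n, w, k, hn, hw, hk, hTk, hKk, hkn, hN⟩ :=
      hlarge ((b * B) ^ (1 / ε)) (by positivity)
    have hk0 : 0 < k := by linarith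
    refine le_trans ?_ (le_iSup₂ (f := fun w (_ : A w) => N w / K w ^ (β - ε)) w hw)
    have h1 : b * B ≤ k ^ ε := by
      have := Real.rpow_le_rpow (by positivity) hTk hε.le
      rwa [← Real.rpow_mul (by positivity), one_div_mul_cancel hε.ne', Real.rpow_one] at this
    calc (B : ℝ≥0∞) = ENNReal.ofReal B := by simp
      _ ≤ ENNReal.ofReal (n / k ^ (β - ε)) := by
          refine ENNReal.ofReal_le_ofReal ?_
          rw [Real.rpow_sub hk0, le_div_iff₀ (by positivity), ← mul_div_assoc,
            div_le_iff₀ (by positivity)]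
          refine le_of_mul_le_mul_left ?_ hb
          calc b * (B * k ^ β) = b * B * k ^ β := by ring
            _ ≤ k ^ ε * (b * n) := by gcongr
            _ = _ := by ring
      _ = ENNReal.ofReal n / K w ^ (β - ε) := by
          rw [hKk, ENNReal.ofReal_rpow_of_pos hk0, ENNReal.ofReal_div_of_pos (by positivity)]
      _ ≤ _ := by gcongr

theorem exists_aRight_attaining (hp : 1 < p) (n : ℕ) (hn : 1 ≤ n) :
    ∃ w, ARight p w ∧ charRight p w ^ (1 / (p - 1)) ≤ ENNReal.ofReal (6 * n) ∧
      ENNReal.ofReal n ≤ opNorm p w maximalRight := by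
  have hp1 : 0 < p - 1 := by linarith
  have hn' : (1 : ℝ) ≤ n := by exact_mod_cast hn
  have hδ : (0 : ℝ) < 1 / n := by positivity
  have hδ1 : (1 : ℝ) / n ≤ 1 := by rw [div_le_one (by linarith)]; exact hn'
  have hchar := charRight_powerWeight_le hp hδ hδ1
  refine ⟨powerWeight p (1 / n), ⟨isWeight_powerWeight hp hδ1,
    hchar.trans_lt ENNReal.ofReal_lt_top⟩, ?_, ?_⟩
  · refine (ENNReal.rpow_le_rpow hchar (by positivity)).trans_eq ?_
    rw [ENNReal.ofReal_rpow_of_pos (by positivity), ← Real.rpow_mul (by positivity),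
      mul_one_div_cancel hp1.ne', Real.rpow_one]
    congr 1
    field_simp
  · have := le_opNorm_powerWeight hp hδ
    rwa [one_div_one_div] at this

/-! ### Reflection -/

theorem setLIntegral_Ioc_comp_neg (g : ℝ → ℝ≥0∞) (a b : ℝ) :
    ∫⁻ t in Ioc a b, g (-t) = ∫⁻ t in Ioc (-b) (-a), g t := by
  have h := (Measure.measurePreserving_neg (volume : Measure ℝ)).setLIntegral_comp_preimage_emb
    (MeasurableEquiv.neg ℝ).measurableEmbedding g (Ioo (-b) (-a))
  rw [← Measure.restrict_congr_set (Ioo_ae_eq_Ioc (a := a)),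
    ← Measure.restrict_congr_set (Ioo_ae_eq_Ioc (a := -b)), ← h]
  simp

theorem mean_comp_neg (g : ℝ → ℝ) (a h : ℝ) :
    mean (fun t => g (-t)) a h = mean g (-a - h) h := by
  unfold mean
  rw [setLIntegral_Ioc_comp_neg (fun t => ENNReal.ofReal (g t))]
  ring_nf

theorem charLeft_eq_charRight_comp_neg (p : ℝ) (w : ℝ → ℝ) :
    charLeft p w = charRight p fun x => w (-x) := by
  unfold charLeft charRight
  refine Equiv.iSup_congr (Equiv.neg ℝ) fun x => iSup_congr fun h => iSup_congr fun _ => ?_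
  rw [Equiv.neg_apply, mean_comp_neg w, mean_comp_neg fun t => w t ^ (1 - p / (p - 1))]
  ring_nf

theorem maximalRight_comp_neg (f : ℝ → ℝ) (x : ℝ) :
    maximalRight (fun t => f (-t)) x = maximalLeft f (-x) := by
  unfold maximalLeft maximalRight
  refine iSup_congr fun h => iSup_congr fun _ => ?_
  rw [setLIntegral_Ioc_comp_neg (fun t => ‖f t‖ₑ)]
  ring_nf

theorem weightMeasure_comp_neg (w : ℝ → ℝ) :
    weightMeasure w = (weightMeasure fun x => w (-x)).map Neg.neg := by
  unfold weightMeasure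
  refine Measure.ext fun s hs => ?_
  rw [Measure.map_apply measurable_neg hs, withDensity_apply _ hs,
    withDensity_apply _ (measurable_neg hs)]
  exact ((Measure.measurePreserving_neg (volume : Measure ℝ)).setLIntegral_comp_preimage_emb
    (MeasurableEquiv.neg ℝ).measurableEmbedding (fun t => ENNReal.ofReal (w t)) s).symm

theorem opNorm_maximalLeft (p : ℝ) (w : ℝ → ℝ) :
    opNorm p w maximalLeft = opNorm p (fun x => w (-x)) maximalRight := by
  have hemb : MeasurableEmbedding (Neg.neg : ℝ → ℝ) := (MeasurableEquiv.neg ℝ).measurableEmbedding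
  unfold opNorm
  have hsurj : Function.Surjective fun (f : ℝ → ℝ) (x : ℝ) => f (-x) :=
    fun f => ⟨fun x => f (-x), by simp⟩
  refine hsurj.iSup_congr _ fun f => ?_
  rw [weightMeasure_comp_neg w, hemb.memLp_map_measure_iff, hemb.eLpNorm_map_measure,
    hemb.eLpNorm_map_measure]
  have h1 : (fun x => f (-x)) = f ∘ Neg.neg := rfl
  have h2 : maximalRight (f ∘ Neg.neg) = maximalLeft f ∘ Neg.neg := by
    ext x; exact maximalRight_comp_neg f x
  simp only [h1, h2]

theorem isWeight_comp_neg {w : ℝ → ℝ} (hw : IsWeight w) : IsWeight fun x => w (-x) := by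
  have hmp := Measure.measurePreserving_neg (volume : Measure ℝ)
  refine ⟨fun x => ?_, hmp.quasiMeasurePreserving.ae hw.ae_pos⟩
  obtain ⟨s, hs, hint⟩ := hw.locallyIntegrable (-x)
  refine ⟨Neg.neg ⁻¹' s, continuous_neg.continuousAt.preimage_mem_nhds hs, ?_⟩
  exact (hmp.integrableOn_comp_preimage (MeasurableEquiv.neg ℝ).measurableEmbedding).2 hint

theorem ALeft.comp_neg {w : ℝ → ℝ} (hw : ALeft p w) : ARight p fun x => w (-x) :=
  ⟨isWeight_comp_neg hw.1, charLeft_eq_charRight_comp_neg p w ▸ hw.2⟩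

theorem ARight.comp_neg {w : ℝ → ℝ} (hw : ARight p w) : ALeft p fun x => w (-x) := by
  refine ⟨isWeight_comp_neg hw.1, ?_⟩
  rw [charLeft_eq_charRight_comp_neg]
  simpa only [neg_neg] using hw.2

end OneSided

theorem theorem2p1 (p : ℝ) (hp : 1 < p) :
    ((∃ c : ℝ≥0, ∀ w : ℝ → ℝ, OneSided.ARight p w →
        OneSided.opNorm p w OneSided.maximalRight ≤ c * OneSided.charRight p w ^ (1 / (p - 1))) ∧
      OneSided.BestPossible (OneSided.ARight p)
        (fun w => OneSided.opNorm p w OneSided.maximalRight) (OneSided.charRight p)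
        (1 / (p - 1))) ∧
    ((∃ c : ℝ≥0, ∀ w : ℝ → ℝ, OneSided.ALeft p w →
        OneSided.opNorm p w OneSided.maximalLeft ≤ c * OneSided.charLeft p w ^ (1 / (p - 1))) ∧
      OneSided.BestPossible (OneSided.ALeft p)
        (fun w => OneSided.opNorm p w OneSided.maximalLeft) (OneSided.charLeft p)
        (1 / (p - 1))) := by
  have hβ : 0 < 1 / (p - 1) := one_div_pos.2 (by linarith)
  obtain ⟨c, hc⟩ := OneSided.opNorm_maximalRight_le hp
  have hcL : ∀ w : ℝ → ℝ, OneSided.ALeft p w →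
      OneSided.opNorm p w OneSided.maximalLeft ≤ c * OneSided.charLeft p w ^ (1 / (p - 1)) := by
    intro w hw
    rw [OneSided.opNorm_maximalLeft, OneSided.charLeft_eq_charRight_comp_neg]
    exact hc _ hw.comp_neg
  refine ⟨⟨⟨c, hc⟩, ?_⟩, ⟨c, hcL⟩, ?_⟩
  · exact OneSided.bestPossible_of_attained hβ (fun w => OneSided.one_le_charRight hp) hc
      (OneSided.exists_aRight_attaining hp)
  · refine OneSided.bestPossible_of_attained (b := 6) hβ (fun w hw => ?_) hcL fun n hn => ?_
    · rw [OneSided.charLeft_eq_charRight_comp_neg]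
      exact OneSided.one_le_charRight hp hw.comp_neg
    · obtain ⟨w, hw, h1, h2⟩ := OneSided.exists_aRight_attaining hp n hn
      refine ⟨fun x => w (-x), hw.comp_neg, ?_, ?_⟩
      · rw [OneSided.charLeft_eq_charRight_comp_neg]
        simpa only [neg_neg] using h1
      · rw [OneSided.opNorm_maximalLeft]
        simpa only [neg_neg] using h2
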